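/- **Model.** Let $\mu\in\mathbb R^p$, $\mu\neq 0$, let $\Sigma\in\mathbb R^{p\times p}$ be positive semidefinite, and let $y$ be a random label with $\mathbb P(y=1)=\mathbb P(y=-1)=1/2$. Let $$x=y\mu+z,\qquad z=g\,\Sigma^{1/2}\xi,$$ where, for some $l\in[2,\infty]$, $k\in(2,4]$, $r\in(2,4]$ and $K>0$: $g\in(0,\infty)$ is a random variable with $\mathbb E g^2=1$, $\mathbb E g^l<\infty$ (essentially bounded if $l=\infty$) and $\mathbb E g^{-k}<\infty$; the random vector $\xi\in\mathbb R^p$ is independent of $g$ and has independent entries with $\mathbb E\xi_j=0$, $\mathbb E\xi_j^2=1$ and $\mathbb E|\xi_j|^r\le K$ for all $j$. There is no label noise: the observed label is $y$. The training sample $(x_i,y_i)$, $i=1,\dots,n$, $n\ge 1$, consists of i.i.d. copies of $(x,y)$. Put $\tilde x=(x,1)$, $\tilde z=(z,1)$, $\tilde\mu=(\mu,0)$ in $\mathbb R^{p+1}$. The maximum margin classifier $\hat{\tilde w}$ is the vector $w\in\mathbb R^{p+1}$ of least Euclidean norm with $y_i\langle w,\tilde x_i\rangle\ge 1$ for all $i$.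 **Theorem (inhomogeneous, noiseless, large signal).** There are constants $C_1(r,K)>0$, depending only on $r$ and $K$, and for every constant $C_H>2$ there is a constant $c>0$, depending only on $C_H$, such that the following holds for every model as above and every $\delta\in(0,\tfrac12)$. Suppose that 1. (large signal) $\displaystyle \|\mu\|\ \ge\ \tfrac{3\sqrt2}{2}\,C_H\,\|g\|_{L^l}\Big(\frac n\delta\Big)^{1/l}\sqrt{\operatorname{Tr}(\Sigma)}$ (with $1/l=0$ if $l=\infty$), and 2. (high dimension) $\displaystyle \operatorname{Tr}(\Sigma)\ \ge\ 2\,C_1(r,K)\Big(\frac n\delta\Big)^{2/r}\max\{p^{2/r-1/2},\,n^{2/r}\}\,\|\Sigma\|_F .$ Then with probability at least $1-2\delta$ over the sample, $\hat{\tilde w}$ exists; for the logistic and for the exponential loss $\ell$, gradient descent on $w\mapsto\sum_{i=1}^n\ell(y_i\langle w,\tilde x_i\rangle)$, from any starting point and with any sufficiently small constant step size (the threshold may depend on the sample and the starting point), has iterates $w_t$ with $w_t/\|w_t\|\to\hat{\tilde w}/\|\hat{\tilde w}\|$; and, for a fresh pair $(x,y)$, $$\mathbb P_{(x,y)}\big(\langle\hat{\tilde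 w},y\tilde x\rangle<0\big)\ \le\ c\,\frac{\|\mathbb E[\tilde z\tilde z^\top]\|}{\|\tilde\mu\|^2}\ =\ c\,\frac{\max(\|\Sigma\|,1)}{\|\mu\|^2},$$ where $\|\cdot\|$ is the spectral norm for matrices and the Euclidean norm for vectors. -/

import Mathlib

open MeasureTheory ProbabilityTheory Filter Topology
open scoped ENNReal MatrixOrder RealInnerProductSpace

noncomputable section

/-- The extended vector `(v, b)` in `ℝ^(p+1)`, with the Euclidean norm. -/
def extendVec {p : ℕ} (v : EuclideanSpace ℝ (Fin p)) (b : ℝ) : EuclideanSpace ℝ (Fin p ⊕ Unit) :=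
  WithLp.toLp 2 (Sum.elim (fun j => v j) (fun _ => b))

/-- The spectral (Euclidean operator) norm of a real square matrix. -/
def specNorm {ι : Type*} [Fintype ι] [DecidableEq ι] (A : Matrix ι ι ℝ) : ℝ :=
  ‖Matrix.toEuclideanCLM (n := ι) (𝕜 := ℝ) A‖

/-- The Frobenius norm of a real square matrix. -/
def frobNorm {ι : Type*} [Fintype ι] (A : Matrix ι ι ℝ) : ℝ :=
  Real.sqrt (∑ a, ∑ b, A a b ^ 2)

/-- The noise vector `z = g S^(1/2) ξ`; `CFC.sqrt S` is the positive semidefinite square root. -/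
def noise {Ω : Type*} {p : ℕ} (S : Matrix (Fin p) (Fin p) ℝ) (g : Ω → ℝ) (ξ : Fin p → Ω → ℝ)
    (ω : Ω) : EuclideanSpace ℝ (Fin p) :=
  g ω • Matrix.toEuclideanCLM (n := Fin p) (𝕜 := ℝ) (CFC.sqrt S) (WithLp.toLp 2 (fun j => ξ j ω))

/-- The feature vector `x = y μ + z`. -/
def feature {Ω : Type*} {p : ℕ} (μ : EuclideanSpace ℝ (Fin p)) (S : Matrix (Fin p) (Fin p) ℝ)
    (y g : Ω → ℝ) (ξ : Fin p → Ω → ℝ) (ω : Ω) : EuclideanSpace ℝ (Fin p) :=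
  y ω • μ + noise S g ξ ω

/-- The extended non-sub-gaussian mixture model (EM), with true label `y`, observed label `yN`,
noise level `η`, radial factor `g` and direction vector `ξ`. -/
structure ModelEM {Ω : Type*} [MeasurableSpace Ω] (P : Measure Ω) {p : ℕ}
    (S : Matrix (Fin p) (Fin p) ℝ) (η r K k : ℝ) (l : ℝ≥0∞)
    (y yN g : Ω → ℝ) (ξ : Fin p → Ω → ℝ) : Prop where
  measurable_y : Measurable y
  measurable_yN : Measurable yN
  measurable_g : Measurable g
  measurable_ξ : ∀ j, Measurable (ξ j)
  /-- the true label is uniform on `{-1, 1}` -/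
  y_pos : P {ω | y ω = 1} = 1 / 2
  y_neg : P {ω | y ω = -1} = 1 / 2
  /-- the observed label is flipped with probability `η` -/
  noise_level : 0 ≤ η ∧ η < 1 / 2
  yN_noisy : P {ω | yN ω = -y ω} = ENNReal.ofReal η
  yN_clean : P {ω | yN ω = y ω} = ENNReal.ofReal (1 - η)
  /-- `g ∈ (0, ∞)`, `E g² = 1`, `E g^l < ∞`, `E g^(-k) < ∞` -/
  l_ge : 2 ≤ l
  k_mem : 2 < k ∧ k ≤ 4
  g_pos : ∀ᵐ ω ∂P, 0 < g ω
  g_sq : ∫ ω, g ω ^ 2 ∂P = 1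
  g_memLp : MemLp g l P
  g_inv : Integrable (fun ω => g ω ^ (-k)) P
  /-- `S` is positive semidefinite -/
  posSemidef : S.PosSemidef
  /-- the entries of `ξ` are independent, and `ξ` is independent of `g` -/
  r_mem : 2 < r ∧ r ≤ 4
  K_pos : 0 < K
  ξ_indep : iIndepFun ξ P
  ξ_indep_g : IndepFun (fun ω j => ξ j ω) g P
  ξ_mean : ∀ j, ∫ ω, ξ j ω ∂P = 0
  ξ_sq : ∀ j, ∫ ω, ξ j ω ^ 2 ∂P = 1
  ξ_integrable : ∀ j, Integrable (fun ω => |ξ j ω| ^ r) P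
  ξ_moment : ∀ j, ∫ ω, |ξ j ω| ^ r ∂P ≤ K

/-- The second moment matrix `E[u uᵀ]` of a random vector `u`. -/
def secondMoment {Ω : Type*} [MeasurableSpace Ω] (P : Measure Ω) {ι : Type*}
    (u : Ω → EuclideanSpace ℝ ι) : Matrix ι ι ℝ :=
  Matrix.of fun a b => ∫ ω, u ω a * u ω b ∂P

/-- `w` is the maximum margin (hard-margin) classifier of the data set `d` of pairs
(feature, label), on the extended features `(x, 1)`: it has minimal norm among the vectors that
satisfy all margin constraints. -/
def IsMaxMargin {n p : ℕ} (d : Fin n → EuclideanSpace ℝ (Fin p) × ℝ)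
    (w : EuclideanSpace ℝ (Fin p ⊕ Unit)) : Prop :=
  (∀ i, 1 ≤ (d i).2 * ⟪w, extendVec (d i).1 1⟫) ∧
    ∀ v : EuclideanSpace ℝ (Fin p ⊕ Unit),
      (∀ i, 1 ≤ (d i).2 * ⟪v, extendVec (d i).1 1⟫) → ‖w‖ ≤ ‖v‖

/-- The logistic loss. -/
def logisticLoss (u : ℝ) : ℝ := Real.log (1 + Real.exp (-u))

/-- The exponential loss. -/
def expLoss (u : ℝ) : ℝ := Real.exp (-u)

/-- The training loss of the inhomogeneous linear classifier `w` on the data set `d`. -/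
def trainLoss (loss : ℝ → ℝ) {n p : ℕ} (d : Fin n → EuclideanSpace ℝ (Fin p) × ℝ)
    (w : EuclideanSpace ℝ (Fin p ⊕ Unit)) : ℝ :=
  ∑ i, loss ((d i).2 * ⟪w, extendVec (d i).1 1⟫)

/-- Gradient descent on `f` with constant step size `α`, started at `w₀`. -/
def gradDescent {ι : Type*} [Fintype ι] (f : EuclideanSpace ℝ ι → ℝ) (α : ℝ)
    (w₀ : EuclideanSpace ℝ ι) : ℕ → EuclideanSpace ℝ ι
  | 0 => w₀
  | t + 1 => gradDescent f α w₀ t - α • gradient f (gradDescent f α w₀ t)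

/-- From every starting point and for all sufficiently small constant step sizes, gradient descent
on the training loss converges in direction to `w`. -/
def GDConvergesInDirection (loss : ℝ → ℝ) {n p : ℕ} (d : Fin n → EuclideanSpace ℝ (Fin p) × ℝ)
    (w : EuclideanSpace ℝ (Fin p ⊕ Unit)) : Prop :=
  ∀ w₀ : EuclideanSpace ℝ (Fin p ⊕ Unit), ∃ α₀ : ℝ, 0 < α₀ ∧ ∀ α : ℝ, 0 < α → α < α₀ →
    Tendsto (fun t : ℕ => ‖gradDescent (trainLoss loss d) α w₀ t‖⁻¹ •
        gradDescent (trainLoss loss d) α w₀ t) atTop (𝓝 (‖w‖⁻¹ • w))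

/-- The test error of the inhomogeneous classifier `w`: the probability that a fresh pair `(x, y)`
satisfies `⟨w, y (x, 1)⟩ < 0`. -/
def testError {Ω : Type*} [MeasurableSpace Ω] (P : Measure Ω) {p : ℕ}
    (x : Ω → EuclideanSpace ℝ (Fin p)) (y : Ω → ℝ) (w : EuclideanSpace ℝ (Fin p ⊕ Unit)) : ℝ :=
  P.real {ω | ⟪w, y ω • extendVec (x ω) 1⟫ < 0}

end

/-! Put θ = 1/2 - 1/C_H. A deterministic argument runs on the event that every sample has noise
‖z_i‖ ≤ ‖μ‖/C_H. There a multiple of (μ, 0) satisfies all margin constraints, so the maximum margin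
vector w exists and (1 - 1/C_H)‖w‖‖μ‖ ≤ 1. Any single constraint on w gives 1 ≤ ⟪w, (μ, 0)⟫ +
‖w‖(‖μ‖/C_H + 1). If θ‖μ‖ ≥ 2, the two together give ⟪w, (μ, 0)⟫ ≥ θ‖w‖‖μ‖
(`IsMaxMargin.norm_mul_le_inner`), and Chebyshev's inequality (`ModelEM.testError_le`) bounds the
test error by ‖E z̃z̃ᵀ‖/(θ‖μ‖)². If θ‖μ‖ < 2, the claimed bound with c = 4/θ² is at least 1.

For the probability of the event, ‖z‖² = g² ξᵀSξ. The factor g is controlled by Markov's inequality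
of order l, or by its essential bound. The form ξᵀSξ rarely exceeds 3 Tr S: its diagonal part is a
sum of independent variables with moments of order r/2, handled by truncation, and its off-diagonal
part has second moment at most 2‖S‖_F². Each of the two failures has probability at most δ/n per
sample, and a union bound gives 2δ.

Gradient descent is treated for one fixed separable data set and any loss with exponential tail
(`IsExpTailed.tendsto_direction`). With loss L and gradient norm G, a step of size α raises -log L
by at least about αG/‖w‖ and lengthens the iterate by at most αG. All margins of the iterate are at
least -log L - log 2, so their ratio to its length is asymptotically the optimal 1/‖w‖, and a nearly
optimal margin forces the direction of w (`sq_norm_le_inner_of_minimal`). -/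

/-! ### Losses with exponential tail -/

/-- A positive decreasing loss `ℓ` with derivative `-h`, whose tail is exponential. -/
structure IsExpTailed (ℓ h : ℝ → ℝ) : Prop where
  hasDerivAt : ∀ z, HasDerivAt ℓ (-h z) z
  pos : ∀ z, 0 < ℓ z
  slope_pos : ∀ z, 0 < h z
  -- This field and the next make slope and loss asymptotically equal as the loss tends to zero. The
  -- error in `step` is weighted by the slope itself, and `margin` amounts to exp (-z) ≤ 2 ℓ z.
  slope_le : ∀ z, h z ≤ ℓ z
  le_slope : ∀ z, ℓ z ≤ h z * (1 + ℓ z)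
  step : ∀ z d, |d| ≤ 1 → ℓ (z + d) ≤ ℓ z + h z * (-d + d ^ 2)
  margin : ∀ z, ℓ z ≤ 1 → -Real.log (ℓ z) - Real.log 2 ≤ z

theorem exp_neg_le_quadratic {d : ℝ} (hd : |d| ≤ 1) : Real.exp (-d) ≤ 1 - d + d ^ 2 := by
  have h := Real.abs_exp_sub_one_sub_id_le (x := -d) (by simpa using hd)
  have := (abs_le.mp h).2
  nlinarith

theorem isExpTailed_expLoss : IsExpTailed expLoss expLoss where
  hasDerivAt z := by
    unfold expLoss
    simpa using (hasDerivAt_neg z).exp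
  pos z := Real.exp_pos _
  slope_pos z := Real.exp_pos _
  slope_le z := le_rfl
  le_slope z := by
    have : 0 < expLoss z := Real.exp_pos _
    nlinarith
  step z d hd := by
    have h1 := exp_neg_le_quadratic hd
    have h2 : expLoss (z + d) = expLoss z * Real.exp (-d) := by
      unfold expLoss; rw [← Real.exp_add]; ring_nf
    have : 0 < expLoss z := Real.exp_pos _
    rw [h2]; nlinarith
  margin z _ := by
    have := Real.log_pos (one_lt_two)
    simp only [expLoss, Real.log_exp]; linarith

theorem isExpTailed_logisticLoss :
    IsExpTailed logisticLoss (fun z => Real.exp (-z) / (1 + Real.exp (-z))) where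
  hasDerivAt z := by
    unfold logisticLoss
    have h := (((hasDerivAt_neg z).exp).const_add 1).log (by positivity)
    convert h using 1
    ring
  pos z := Real.log_pos (by linarith [Real.exp_pos (-z)])
  slope_pos z := by positivity
  slope_le z := by
    have hp : 0 < Real.exp (-z) := Real.exp_pos _
    have h := Real.one_sub_inv_le_log_of_pos (x := 1 + Real.exp (-z)) (by positivity)
    have e : 1 - (1 + Real.exp (-z))⁻¹ = Real.exp (-z) / (1 + Real.exp (-z)) := by
      field_simp; ring
    rwa [e] at h
  le_slope z := by
    have hp : 0 < Real.exp (-z) := Real.exp_pos _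
    have h := Real.log_le_sub_one_of_pos (x := 1 + Real.exp (-z)) (by positivity)
    simp only [logisticLoss]
    rw [div_mul_eq_mul_div, le_div_iff₀ (by positivity)]
    nlinarith
  step z d hd := by
    have h1 := exp_neg_le_quadratic hd
    have hp : 0 < Real.exp (-z) := Real.exp_pos _
    have hq : 0 < Real.exp (-d) := Real.exp_pos _
    simp only [logisticLoss]
    -- Applying log x ≤ x - 1 to the ratio of the two arguments reduces the logistic case to the
    -- quadratic bound on exp (-d).
    have e : 1 + Real.exp (-(z + d)) = (1 + Real.exp (-z)) *
        ((1 + Real.exp (-z) * Real.exp (-d)) / (1 + Real.exp (-z))) := by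
      rw [neg_add, Real.exp_add]; field_simp
    have e2 : (1 + Real.exp (-z) * Real.exp (-d)) / (1 + Real.exp (-z)) - 1 =
        Real.exp (-z) / (1 + Real.exp (-z)) * (Real.exp (-d) - 1) := by
      field_simp; ring
    rw [e, Real.log_mul (by positivity) (by positivity)]
    have h := Real.log_le_sub_one_of_pos
      (x := (1 + Real.exp (-z) * Real.exp (-d)) / (1 + Real.exp (-z))) (by positivity)
    rw [e2] at h
    have h3 : Real.exp (-z) / (1 + Real.exp (-z)) * (Real.exp (-d) - 1) ≤
        Real.exp (-z) / (1 + Real.exp (-z)) * (-d + d ^ 2) := by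
      gcongr; linarith
    linarith
  margin z hz := by
    have hp : 0 < Real.exp (-z) := Real.exp_pos _
    set L := logisticLoss z with hL
    have hL0 : 0 < L := Real.log_pos (by linarith)
    have e : Real.exp (-z) = Real.exp L - 1 := by
      rw [hL, logisticLoss, Real.exp_log (by positivity)]; ring
    have h1 : Real.exp L - 1 ≤ 2 * L := by
      have := Real.abs_exp_sub_one_le (x := L) (by rw [abs_of_pos hL0]; exact hz)
      rw [abs_of_pos hL0] at this
      exact (le_abs_self _).trans this
    have h2 : -z ≤ Real.log (2 * L) := by
      rw [Real.le_log_iff_exp_le (by positivity)]; linarith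
    rw [Real.log_mul (by norm_num) hL0.ne'] at h2
    linarith

/-! ### Least-norm vectors under margin constraints -/

section Separable

variable {V : Type*} [NormedAddCommGroup V] [InnerProductSpace ℝ V] {κ : Type*}

/-- A vector of least norm among the `w` with `1 ≤ ⟪w, a i⟫` for all `i` makes an acute angle
with every such `w`. -/
theorem sq_norm_le_inner_of_minimal {a : κ → V} {u v : V} (hu : ∀ i, 1 ≤ ⟪u, a i⟫)
    (hmin : ∀ v : V, (∀ i, 1 ≤ ⟪v, a i⟫) → ‖u‖ ≤ ‖v‖) (hv : ∀ i, 1 ≤ ⟪v, a i⟫) :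
    ‖u‖ ^ 2 ≤ ⟪u, v⟫ := by
  by_contra! hlt
  set D := ‖u‖ ^ 2 - ⟪u, v⟫ with hD
  have hDpos : 0 < D := by linarith
  set N := ‖v - u‖ ^ 2 with hN
  have hN0 : 0 ≤ N := by positivity
  -- Moving from u towards v by s changes the squared norm by -2sD + s²N, which is negative for this
  -- s; the + 1 covers N = 0.
  set s := min 1 (D / (N + 1)) with hs
  have hs0 : 0 < s := lt_min one_pos (by positivity)
  have hs1 : s ≤ 1 := min_le_left _ _
  have hsN : s * (N + 1) ≤ D := by
    have : s ≤ D / (N + 1) := min_le_right _ _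
    rwa [le_div_iff₀ (by positivity)] at this
  have hfeas : ∀ i, 1 ≤ ⟪u + s • (v - u), a i⟫ := fun i => by
    rw [inner_add_left, real_inner_smul_left, inner_sub_left]
    nlinarith [hu i, hv i]
  have h := hmin _ hfeas
  have h2 : ‖u‖ ^ 2 ≤ ‖u + s • (v - u)‖ ^ 2 := by gcongr
  rw [norm_add_sq_real, real_inner_smul_right, inner_sub_right, real_inner_self_eq_norm_sq,
    norm_smul, mul_pow, Real.norm_eq_abs, sq_abs] at h2
  nlinarith

/-- There is a vector of least norm satisfying all the margin constraints, if some vector does. -/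
theorem exists_minimal_norm [FiniteDimensional ℝ V] {a : κ → V} (h : ∃ v : V, ∀ i, 1 ≤ ⟪v, a i⟫) :
    ∃ u : V, (∀ i, 1 ≤ ⟪u, a i⟫) ∧ ∀ v : V, (∀ i, 1 ≤ ⟪v, a i⟫) → ‖u‖ ≤ ‖v‖ := by
  have hc : IsClosed {v : V | ∀ i, 1 ≤ ⟪v, a i⟫} := by
    simp only [Set.ofPred_forall]
    exact isClosed_iInter fun i => isClosed_le (by fun_prop) (by fun_prop)
  have : ProperSpace V := FiniteDimensional.proper ℝ V
  obtain ⟨u, hu, hd⟩ := hc.exists_infDist_eq_dist h 0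
  refine ⟨u, hu, fun v hv => ?_⟩
  have := Metric.infDist_le_dist_of_mem (x := (0 : V)) (show v ∈ {v : V | ∀ i, 1 ≤ ⟪v, a i⟫} from hv)
  rw [hd] at this
  simpa using this

end Separable

/-! ### Gradient descent on separable data -/

section GradientDescent

variable {V : Type*} [NormedAddCommGroup V] [InnerProductSpace ℝ V] {κ : Type*} [Fintype κ]

/-- The total loss of `w` on the signed features `a`. -/
def totalLoss (ℓ : ℝ → ℝ) (a : κ → V) (w : V) : ℝ := ∑ i, ℓ ⟪w, a i⟫

/-- The descent direction of the total loss whose summands have derivative `-h`. -/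
def descentDir (h : ℝ → ℝ) (a : κ → V) (w : V) : V := ∑ i, h ⟪w, a i⟫ • a i

variable {ℓ h : ℝ → ℝ} {a : κ → V}

theorem IsExpTailed.hasGradientAt [CompleteSpace V] (hE : IsExpTailed ℓ h) (a : κ → V) (w : V) :
    HasGradientAt (totalLoss ℓ a) (-descentDir h a w) w := by
  rw [hasGradientAt_iff_hasFDerivAt]
  have h1 : ∀ i ∈ (Finset.univ : Finset κ), HasFDerivAt (fun w : V => ℓ ⟪w, a i⟫)
      (-h ⟪w, a i⟫ • (innerSL ℝ (a i))) w := fun i _ => by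
    have h2 : HasFDerivAt (fun w : V => ⟪w, a i⟫) (innerSL ℝ (a i)) w := by
      have := (innerSL ℝ (a i)).hasFDerivAt (x := w)
      refine this.congr_of_eventuallyEq (Eventually.of_forall fun v => ?_)
      simp [real_inner_comm]
    exact (hE.hasDerivAt _).comp_hasFDerivAt w h2
  have h3 := HasFDerivAt.fun_sum h1
  refine h3.congr_fderiv ?_
  ext v
  simp [descentDir]

theorem IsExpTailed.totalLoss_pos [Nonempty κ] (hE : IsExpTailed ℓ h) (w : V) :
    0 < totalLoss ℓ a w :=
  Finset.sum_pos (fun _ _ => hE.pos _) Finset.univ_nonempty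

theorem IsExpTailed.le_totalLoss (hE : IsExpTailed ℓ h) (w : V) (i : κ) :
    ℓ ⟪w, a i⟫ ≤ totalLoss ℓ a w :=
  Finset.single_le_sum (f := fun i => ℓ ⟪w, a i⟫) (fun _ _ => (hE.pos _).le) (Finset.mem_univ i)

theorem IsExpTailed.norm_descentDir_le (hE : IsExpTailed ℓ h) {B : ℝ} (hB : ∀ i, ‖a i‖ ≤ B)
    (w : V) : ‖descentDir h a w‖ ≤ B * ∑ i, h ⟪w, a i⟫ := by
  rw [Finset.mul_sum]
  refine norm_sum_le_of_le _ fun i _ => ?_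
  rw [norm_smul, Real.norm_eq_abs, abs_of_pos (hE.slope_pos _), mul_comm]
  exact mul_le_mul_of_nonneg_right (hB i) (hE.slope_pos _).le

theorem IsExpTailed.sum_slope_le (hE : IsExpTailed ℓ h) (w : V) :
    ∑ i, h ⟪w, a i⟫ ≤ totalLoss ℓ a w :=
  Finset.sum_le_sum fun _ _ => hE.slope_le _

/-- One step of gradient descent decreases the loss. -/
theorem IsExpTailed.totalLoss_step_le (hE : IsExpTailed ℓ h) {B α : ℝ} (hB0 : 0 ≤ B)
    (hB : ∀ i, ‖a i‖ ≤ B) (hα : 0 ≤ α) (w : V) (hs : α * B ^ 2 * totalLoss ℓ a w ≤ 1) :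
    totalLoss ℓ a (w + α • descentDir h a w) ≤ totalLoss ℓ a w -
      α * ‖descentDir h a w‖ ^ 2 * (1 - α * B ^ 2 * totalLoss ℓ a w) := by
  set G := descentDir h a w with hG
  set L := totalLoss ℓ a w with hL
  have hH := hE.sum_slope_le (a := a) w
  have hH0 : 0 ≤ ∑ i, h ⟪w, a i⟫ := Finset.sum_nonneg fun i _ => (hE.slope_pos _).le
  have hGn := hE.norm_descentDir_le hB w
  have hd : ∀ i, |α * ⟪G, a i⟫| ≤ α * (‖G‖ * B) := fun i => by
    rw [abs_mul, abs_of_nonneg hα]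
    gcongr
    exact (abs_real_inner_le_norm _ _).trans (by gcongr; exact hB i)
  -- No margin moves by more than 1 in one step, as the `step` bound requires.
  have hd1 : α * (‖G‖ * B) ≤ 1 := by
    refine le_trans ?_ hs
    have : ‖G‖ * B ≤ B ^ 2 * L := by
      have : ‖G‖ ≤ B * L := hGn.trans (by gcongr)
      nlinarith
    nlinarith
  have key : ∀ i, ℓ ⟪w + α • G, a i⟫ ≤ ℓ ⟪w, a i⟫ - α * (h ⟪w, a i⟫ * ⟪G, a i⟫) +
      α ^ 2 * (‖G‖ * B) ^ 2 * h ⟪w, a i⟫ := fun i => by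
    rw [inner_add_left, real_inner_smul_left]
    have h1 := hE.step ⟪w, a i⟫ (α * ⟪G, a i⟫) ((hd i).trans hd1)
    have h2 : (α * ⟪G, a i⟫) ^ 2 ≤ (α * (‖G‖ * B)) ^ 2 := by
      rw [← sq_abs]; gcongr; exact hd i
    have h3 := hE.slope_pos ⟪w, a i⟫
    nlinarith
  have hsum : totalLoss ℓ a (w + α • G) ≤ L - α * ‖G‖ ^ 2 +
      α ^ 2 * (‖G‖ * B) ^ 2 * ∑ i, h ⟪w, a i⟫ := by
    refine (Finset.sum_le_sum fun i _ => key i).trans (le_of_eq ?_)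
    rw [Finset.sum_add_distrib, Finset.sum_sub_distrib, ← Finset.mul_sum, ← Finset.mul_sum]
    congr 3
    -- The slopes are the coefficients of the descent direction, so the first-order terms add up to
    -- its squared norm.
    rw [← real_inner_self_eq_norm_sq, hG]
    nth_rewrite 3 [descentDir]
    rw [inner_sum]
    simp [real_inner_smul_right]
  have : α ^ 2 * (‖G‖ * B) ^ 2 * ∑ i, h ⟪w, a i⟫ ≤ α ^ 2 * (‖G‖ * B) ^ 2 * L := by gcongr
  linarith

/-- Pairing the descent direction with u bounds the sum of the slopes by ‖u‖ times its norm, since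
every ⟪u, a i⟫ is at least 1. Hence a small gradient forces a small loss, with the sharp constant
‖u‖ that later identifies the optimal margin. -/
theorem IsExpTailed.totalLoss_le_norm_descentDir (hE : IsExpTailed ℓ h) {u : V}
    (hu : ∀ i, 1 ≤ ⟪u, a i⟫) (w : V) :
    totalLoss ℓ a w ≤ ‖u‖ * ‖descentDir h a w‖ * (1 + totalLoss ℓ a w) := by
  have hL : 0 ≤ totalLoss ℓ a w := Finset.sum_nonneg fun _ _ => (hE.pos _).le
  have h1 : ∑ i, h ⟪w, a i⟫ ≤ ‖u‖ * ‖descentDir h a w‖ := by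
    refine le_trans ?_ (real_inner_le_norm _ _)
    rw [descentDir, inner_sum]
    refine Finset.sum_le_sum fun i _ => ?_
    rw [real_inner_smul_right]
    exact le_mul_of_one_le_right (hE.slope_pos _).le (hu i)
  have h2 : totalLoss ℓ a w ≤ (∑ i, h ⟪w, a i⟫) * (1 + totalLoss ℓ a w) := by
    rw [Finset.sum_mul]
    refine Finset.sum_le_sum fun i _ => (hE.le_slope _).trans ?_
    gcongr
    · exact (hE.slope_pos _).le
    · exact hE.le_totalLoss w i
  exact h2.trans (by gcongr)

/-- Gradient descent on separable data converges in direction to the maximum margin vector. -/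
theorem IsExpTailed.tendsto_direction [Nonempty κ] (hE : IsExpTailed ℓ h) {u : V}
    (hu : ∀ i, 1 ≤ ⟪u, a i⟫) (hmin : ∀ v : V, (∀ i, 1 ≤ ⟪v, a i⟫) → ‖u‖ ≤ ‖v‖)
    {B α : ℝ} (hB0 : 0 ≤ B) (hB : ∀ i, ‖a i‖ ≤ B) (hα : 0 < α) {w : ℕ → V}
    (hw : ∀ t, w (t + 1) = w t + α • descentDir h a (w t))
    (hs : α * B ^ 2 * totalLoss ℓ a (w 0) ≤ 1 / 2) :
    Tendsto (fun t => ‖w t‖⁻¹ • w t) atTop (𝓝 (‖u‖⁻¹ • u)) := by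
  obtain ⟨i₀⟩ := ‹Nonempty κ›
  have hne : Nonempty κ := ⟨i₀⟩
  set L : ℕ → ℝ := fun t => totalLoss ℓ a (w t) with hL
  set G : ℕ → ℝ := fun t => ‖descentDir h a (w t)‖ with hG
  have hLpos : ∀ t, 0 < L t := fun t => hE.totalLoss_pos _
  have hG0 : ∀ t, 0 ≤ G t := fun t => norm_nonneg _
  have hN : 0 < ‖u‖ := by
    rw [norm_pos_iff]
    rintro rfl
    have := hu i₀
    simp at this
    linarith
  have hstep0 : ∀ t, α * B ^ 2 * L t ≤ 1 → L (t + 1) ≤ L t - α * G t ^ 2 * (1 - α * B ^ 2 * L t) :=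
    fun t ht => by
      have := hE.totalLoss_step_le hB0 hB hα.le (w t) ht
      simpa only [hL, hG, hw t] using this
  -- The step-size condition at the start persists because the loss decreases while it holds.
  have hle : ∀ t, α * B ^ 2 * L t ≤ 1 / 2 := by
    intro t
    induction t with
    | zero => exact hs
    | succ t ih =>
      have h1 := hstep0 t (by linarith)
      have h2 : 0 ≤ α * G t ^ 2 * (1 - α * B ^ 2 * L t) :=
        mul_nonneg (by positivity) (by linarith)
      have h3 : α * B ^ 2 * L (t + 1) ≤ α * B ^ 2 * L t := by gcongr; linarith
      linarith
  have hstep : ∀ t, L (t + 1) ≤ L t - α * G t ^ 2 * (1 - α * B ^ 2 * L t) :=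
    fun t => hstep0 t (by linarith [hle t])
  have hhalf : ∀ t, α / 2 * G t ^ 2 ≤ L t - L (t + 1) := fun t => by
    have h0 : 0 ≤ α * G t ^ 2 := by positivity
    nlinarith [hstep t, hle t]
  have hanti : Antitone L := antitone_nat_of_succ_le fun t => by
    have : 0 ≤ α / 2 * G t ^ 2 := by positivity
    linarith [hhalf t]
  have hlow : ∀ t, L t ≤ ‖u‖ * G t * (1 + L t) := fun t => hE.totalLoss_le_norm_descentDir hu _
  obtain ⟨m, hm⟩ : ∃ m, Tendsto L atTop (𝓝 m) :=
    ⟨_, tendsto_atTop_ciInf hanti ⟨0, by rintro _ ⟨t, rfl⟩; exact (hLpos t).le⟩⟩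
  -- The squared gradient norm is dominated by the loss decrement, which tends to zero since the
  -- loss converges.
  have hGlim : Tendsto G atTop (𝓝 0) := by
    have h1 : Tendsto (fun t => L t - L (t + 1)) atTop (𝓝 0) := by
      simpa using hm.sub (hm.comp (tendsto_add_atTop_nat 1))
    have h2 : Tendsto (fun t => G t ^ 2) atTop (𝓝 0) := by
      refine squeeze_zero (g := fun t => 2 / α * (L t - L (t + 1))) (fun t => by positivity)
        (fun t => ?_) (by simpa using h1.const_mul (2 / α))
      have := hhalf t
      rw [div_mul_eq_mul_div, le_div_iff₀ hα]
      linarith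
    have h3 := h2.sqrt
    simpa [Real.sqrt_sq (hG0 _)] using h3
  have hLlim : Tendsto L atTop (𝓝 0) := by
    refine squeeze_zero (g := fun t => ‖u‖ * G t * (1 + L 0)) (fun t => (hLpos t).le) (fun t => ?_)
      (by simpa using (hGlim.const_mul ‖u‖).mul_const (1 + L 0))
    refine (hlow t).trans ?_
    have := hanti (Nat.zero_le t)
    have := hG0 t
    gcongr
  have hmargin : ∀ᶠ t in atTop, ∀ i, -Real.log (L t) - Real.log 2 ≤ ⟪w t, a i⟫ := by
    filter_upwards [hLlim.eventually (gt_mem_nhds one_pos)] with t ht i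
    have h1 := hE.le_totalLoss (a := a) (w t) i
    have h2 := hE.margin ⟪w t, a i⟫ (h1.trans ht.le)
    have h3 := Real.log_le_log (hE.pos _) h1
    have h4 : Real.log (totalLoss ℓ a (w t)) = Real.log (L t) := rfl
    linarith
  have hloglim : Tendsto (fun t => -Real.log (L t)) atTop atTop := by
    refine tendsto_neg_atBot_atTop.comp (Real.tendsto_log_nhdsGT_zero.comp ?_)
    exact tendsto_nhdsWithin_iff.mpr ⟨hLlim, Eventually.of_forall hLpos⟩
  have hnorm : Tendsto (fun t => ‖w t‖) atTop atTop := by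
    have h1 : Tendsto (fun t => (B + 1)⁻¹ * (-Real.log (L t) - Real.log 2)) atTop atTop :=
      (tendsto_atTop_add_const_right _ _ hloglim).const_mul_atTop (by positivity)
    refine tendsto_atTop_mono' _ ?_ h1
    filter_upwards [hmargin] with t ht
    rw [inv_mul_le_iff₀ (by positivity)]
    have h2 : ⟪w t, a i₀⟫ ≤ ‖w t‖ * B :=
      (real_inner_le_norm _ _).trans (by gcongr; exact hB i₀)
    nlinarith [ht i₀, norm_nonneg (w t)]
  -- The relative decrease of the loss is of order αG²/L; the bound L ≤ ‖u‖ G (1 + L) turns one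
  -- factor G/L into 1/‖u‖.
  have hlog : ∀ t, ‖u‖ * -Real.log (L t) + α * G t * ((1 - α * B ^ 2 * L t) / (1 + L t)) ≤
      ‖u‖ * -Real.log (L (t + 1)) := fun t => by
    have h1 : Real.log (L (t + 1)) ≤ Real.log (L t) + (L (t + 1) / L t - 1) := by
      have := Real.log_le_sub_one_of_pos (div_pos (hLpos (t + 1)) (hLpos t))
      rw [Real.log_div (hLpos _).ne' (hLpos _).ne'] at this
      linarith
    have h2 : L (t + 1) / L t - 1 ≤ -(α * G t ^ 2 * (1 - α * B ^ 2 * L t) / L t) := by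
      rw [div_sub_one (hLpos t).ne', ← neg_div]
      gcongr
      · exact (hLpos t).le
      · linarith [hstep t]
    have hq : 0 ≤ 1 - α * B ^ 2 * L t := by linarith [hle t]
    have h3 : α * G t * ((1 - α * B ^ 2 * L t) / (1 + L t)) ≤
        ‖u‖ * (α * G t ^ 2 * (1 - α * B ^ 2 * L t) / L t) := by
      have := hLpos t
      rw [← mul_div_assoc, ← mul_div_assoc, div_le_div_iff₀ (by positivity) (hLpos t)]
      have h4 := mul_le_mul_of_nonneg_left (hlow t)
        (mul_nonneg (mul_nonneg hα.le (hG0 t)) hq)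
      linarith
    nlinarith
  have hq : Tendsto (fun t => (1 - α * B ^ 2 * L t) / (1 + L t)) atTop (𝓝 1) := by
    have : Tendsto (fun t => (1 - α * B ^ 2 * L t) / (1 + L t)) atTop
        (𝓝 ((1 - α * B ^ 2 * 0) / (1 + 0))) :=
      ((hLlim.const_mul (α * B ^ 2)).const_sub 1).div (hLlim.const_add 1) (by norm_num)
    simpa using this
  have hgrow : ∀ t, ‖w (t + 1)‖ ≤ ‖w t‖ + α * G t := fun t => by
    rw [hw t]
    refine (norm_add_le _ _).trans ?_
    rw [norm_smul, Real.norm_eq_abs, abs_of_pos hα]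
  -- The increments αG both drive -log L and bound the growth of the norm, so their sum cancels; C
  -- absorbs the time before the factor in `hlog` exceeds 1 - ε.
  have hlin : ∀ ε > 0, ε < 1 → ∃ C, ∀ᶠ t in atTop,
      (1 - ε) * ‖w t‖ - C ≤ ‖u‖ * -Real.log (L t) := by
    intro ε hε hε1
    obtain ⟨T, hT⟩ := eventually_atTop.mp (hq.eventually (lt_mem_nhds (show 1 - ε < 1 by linarith)))
    refine ⟨(1 - ε) * ‖w T‖ - ‖u‖ * -Real.log (L T), eventually_atTop.mpr ⟨T, fun t ht => ?_⟩⟩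
    induction t, ht using Nat.le_induction with
    | base => linarith
    | succ t ht ih =>
      have h1 := hlog t
      have h2 := hgrow t
      have h3 : α * G t * (1 - ε) ≤ α * G t * ((1 - α * B ^ 2 * L t) / (1 + L t)) :=
        mul_le_mul_of_nonneg_left (hT t ht).le (mul_nonneg hα.le (hG0 t))
      have h4 : (1 - ε) * ‖w (t + 1)‖ ≤ (1 - ε) * (‖w t‖ + α * G t) :=
        mul_le_mul_of_nonneg_left h2 (by linarith)
      linarith
  have hinner : Tendsto (fun t => ⟪‖w t‖⁻¹ • w t, ‖u‖⁻¹ • u⟫) atTop (𝓝 1) := by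
    refine tendsto_order.mpr ⟨fun b hb => ?_, fun b hb => ?_⟩
    -- Since 1 - b ≥ 2ε, a norm above C'/ε makes (1 - ε)‖w t‖ - C' exceed b‖w t‖.
    · set ε := min ((1 - b) / 2) (1 / 2) with hεdef
      have hε : 0 < ε := lt_min (by linarith) (by norm_num)
      have hε1 : ε < 1 := lt_of_le_of_lt (min_le_right _ _) (by norm_num)
      have hεb : ε ≤ (1 - b) / 2 := min_le_left _ _
      obtain ⟨C, hC⟩ := hlin ε hε hε1
      set C' := C + ‖u‖ * Real.log 2 with hC'
      filter_upwards [hC, hmargin, hnorm.eventually_gt_atTop 0,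
        hnorm.eventually_gt_atTop (C' / (1 - ε)), hnorm.eventually_gt_atTop (C' / ε)]
        with t h1 h2 h3 h4 h5
      rw [div_lt_iff₀ (by linarith)] at h4
      rw [div_lt_iff₀ hε] at h5
      -- M is a positive lower bound for all margins of the iterate, so the iterate divided by M is
      -- feasible and can be compared with u.
      set M := ((1 - ε) * ‖w t‖ - C') / ‖u‖ with hM
      have hMpos : 0 < M := div_pos (by linarith) hN
      have hMN : M * ‖u‖ = (1 - ε) * ‖w t‖ - C' := div_mul_cancel₀ _ hN.ne'
      have hfeas : ∀ i, 1 ≤ ⟪M⁻¹ • w t, a i⟫ := fun i => by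
        rw [real_inner_smul_left, le_inv_mul_iff₀ hMpos, mul_one]
        have h6 := mul_le_mul_of_nonneg_left (h2 i) hN.le
        have h7 : M * ‖u‖ ≤ ⟪w t, a i⟫ * ‖u‖ := by rw [hMN]; linarith
        exact le_of_mul_le_mul_right h7 hN
      have h8 := sq_norm_le_inner_of_minimal hu hmin hfeas
      rw [real_inner_smul_right, le_inv_mul_iff₀ hMpos] at h8
      rw [real_inner_smul_left, real_inner_smul_right, real_inner_comm, lt_inv_mul_iff₀ h3,
        lt_inv_mul_iff₀ hN]
      have h9 : ‖u‖ * (‖w t‖ * b) < ‖u‖ * (M * ‖u‖) := by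
        refine mul_lt_mul_of_pos_left ?_ hN
        rw [hMN]
        nlinarith
      linarith
    · refine Eventually.of_forall fun t => lt_of_le_of_lt ?_ hb
      refine (real_inner_le_norm _ _).trans ?_
      rw [norm_smul, norm_smul, norm_inv, norm_inv, norm_norm, norm_norm, inv_mul_cancel₀ hN.ne',
        mul_one]
      exact inv_mul_le_one
  rw [tendsto_iff_norm_sub_tendsto_zero]
  have hsq : Tendsto (fun t => ‖‖w t‖⁻¹ • w t - ‖u‖⁻¹ • u‖ ^ 2) atTop (𝓝 0) := by
    have h1 : Tendsto (fun t => 2 - 2 * ⟪‖w t‖⁻¹ • w t, ‖u‖⁻¹ • u⟫) atTop (𝓝 0) := by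
      have := (hinner.const_mul 2).const_sub 2
      simpa using this
    refine h1.congr' ?_
    filter_upwards [hnorm.eventually_gt_atTop 0] with t ht
    rw [norm_sub_sq_real, norm_smul, norm_smul, norm_inv, norm_inv, norm_norm, norm_norm,
      inv_mul_cancel₀ hN.ne', inv_mul_cancel₀ ht.ne']
    ring
  have := hsq.sqrt
  simpa using this

end GradientDescent

/-- A loss with exponential tail: gradient descent on separable data converges in direction to the
maximum margin classifier. -/
theorem IsMaxMargin.gdConvergesInDirection {ℓ h : ℝ → ℝ} (hE : IsExpTailed ℓ h) {n p : ℕ}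
    (hn : 0 < n) {d : Fin n → EuclideanSpace ℝ (Fin p) × ℝ} {w : EuclideanSpace ℝ (Fin p ⊕ Unit)}
    (hw : IsMaxMargin d w) : GDConvergesInDirection ℓ d w := by
  have : Nonempty (Fin n) := ⟨⟨0, hn⟩⟩
  set a : Fin n → EuclideanSpace ℝ (Fin p ⊕ Unit) := fun i => (d i).2 • extendVec (d i).1 1 with ha
  have hin : ∀ v i, ⟪v, a i⟫ = (d i).2 * ⟪v, extendVec (d i).1 1⟫ := fun v i => by
    rw [ha, real_inner_smul_right]
  have hloss : trainLoss ℓ d = totalLoss ℓ a := by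
    funext v
    simp only [trainLoss, totalLoss, hin]
  intro w₀
  set B := ∑ i, ‖a i‖ with hB
  have hB0 : 0 ≤ B := Finset.sum_nonneg fun _ _ => norm_nonneg _
  have hL := hE.totalLoss_pos (a := a) w₀
  have hX : 0 ≤ B ^ 2 * totalLoss ℓ a w₀ := by positivity
  -- The threshold enforces α B² L ≤ 1/2 at the starting point; the + 1 keeps the denominator
  -- positive.
  refine ⟨1 / 2 / (B ^ 2 * totalLoss ℓ a w₀ + 1), by positivity, fun α hα hα₀ => ?_⟩
  refine hE.tendsto_direction (a := a) (B := B) (α := α) (u := w)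
    (fun i => by rw [hin]; exact hw.1 i)
    (fun v hv => hw.2 v fun i => by rw [← hin]; exact hv i) hB0
    (fun i => Finset.single_le_sum (f := fun i => ‖a i‖) (fun _ _ => norm_nonneg _)
      (Finset.mem_univ i)) hα (fun t => ?_) ?_
  · rw [hloss, gradDescent, (hE.hasGradientAt a _).gradient, smul_neg, sub_neg_eq_add]
  · rw [lt_div_iff₀ (by positivity)] at hα₀
    simp only [gradDescent]
    nlinarith

/-! ### Moments and tails of sums and quadratic forms -/

section Concentration

variable {Ω : Type*} [MeasurableSpace Ω] {P : Measure Ω}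

/-- Markov's inequality for the measure of an upper level set. -/
theorem measureReal_gt_le_integral_div [IsFiniteMeasure P] {f : Ω → ℝ} (hf0 : ∀ ω, 0 ≤ f ω)
    (hf : Integrable f P) {c : ℝ} (hc : 0 < c) : P.real {ω | c < f ω} ≤ (∫ ω, f ω ∂P) / c := by
  rw [le_div_iff₀' hc]
  refine le_trans ?_ (mul_meas_ge_le_integral_of_nonneg (Eventually.of_forall hf0) hf c)
  exact mul_le_mul_of_nonneg_left
    (measureReal_mono (fun ω (hω : c < f ω) => hω.le) (measure_ne_top _ _)) hc.le

section Orthonormal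

variable {ι : Type*} {ξ : ι → Ω → ℝ}

theorem memLp_two_of_integral_sq_eq_one {X : Ω → ℝ} (hm : Measurable X)
    (h2 : ∫ ω, X ω ^ 2 ∂P = 1) : MemLp X 2 P :=
  (memLp_two_iff_integrable_sq hm.aestronglyMeasurable).mpr (integrable_of_integral_eq_one h2)

theorem integrable_mul_of_standardized (hm : ∀ j, Measurable (ξ j))
    (h2 : ∀ j, ∫ ω, ξ j ω ^ 2 ∂P = 1) (i j : ι) : Integrable (fun ω => ξ i ω * ξ j ω) P :=
  (memLp_two_of_integral_sq_eq_one (hm i) (h2 i)).integrable_mul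
    (memLp_two_of_integral_sq_eq_one (hm j) (h2 j))

theorem integral_mul_of_standardized [DecidableEq ι] (hm : ∀ j, Measurable (ξ j))
    (hi : iIndepFun ξ P) (h0 : ∀ j, ∫ ω, ξ j ω ∂P = 0) (h2 : ∀ j, ∫ ω, ξ j ω ^ 2 ∂P = 1)
    (i j : ι) : ∫ ω, ξ i ω * ξ j ω ∂P = if i = j then 1 else 0 := by
  split_ifs with h
  · subst h
    simpa [sq] using h2 i
  · rw [(hi.indepFun h).integral_fun_mul_eq_mul_integral (hm i).aestronglyMeasurable
      (hm j).aestronglyMeasurable, h0, zero_mul]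

theorem memLp_linear_of_standardized (hm : ∀ j, Measurable (ξ j))
    (h2 : ∀ j, ∫ ω, ξ j ω ^ 2 ∂P = 1) (c : ι → ℝ) (s : Finset ι) :
    MemLp (fun ω => ∑ j ∈ s, c j * ξ j ω) 2 P :=
  memLp_finsetSum s fun j _ => (memLp_two_of_integral_sq_eq_one (hm j) (h2 j)).const_mul (c j)

theorem integral_sq_linear_of_standardized (hm : ∀ j, Measurable (ξ j))
    (hi : iIndepFun ξ P) (h0 : ∀ j, ∫ ω, ξ j ω ∂P = 0) (h2 : ∀ j, ∫ ω, ξ j ω ^ 2 ∂P = 1)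
    (c : ι → ℝ) (s : Finset ι) :
    ∫ ω, (∑ j ∈ s, c j * ξ j ω) ^ 2 ∂P = ∑ j ∈ s, c j ^ 2 := by
  classical
  have h1 : ∀ ω, (∑ j ∈ s, c j * ξ j ω) ^ 2 =
      ∑ i ∈ s, ∑ j ∈ s, c i * c j * (ξ i ω * ξ j ω) := fun ω => by
    rw [sq, Finset.sum_mul_sum]
    exact Finset.sum_congr rfl fun i _ => Finset.sum_congr rfl fun j _ => by ring
  have hint := integrable_mul_of_standardized (P := P) hm h2
  simp_rw [h1]
  rw [integral_finsetSum _ fun i _ => integrable_finsetSum _ fun j _ =>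
    (hint i j).const_mul _]
  refine Finset.sum_congr rfl fun i hi' => ?_
  rw [integral_finsetSum _ fun j _ => (hint i j).const_mul _]
  simp_rw [integral_const_mul, integral_mul_of_standardized hm hi h0 h2]
  simp [hi', sq]

/-- The second moment of `Q + 2 X Y` when the standardized `X` is independent of `(Y, Q)`. -/
theorem integral_sq_add_two_mul [IsFiniteMeasure P] {X Y Q : Ω → ℝ} (hXm : Measurable X)
    (hind : IndepFun X (fun ω => (Y ω, Q ω)) P) (h0 : ∫ ω, X ω ∂P = 0)
    (h2 : ∫ ω, X ω ^ 2 ∂P = 1) (hY : MemLp Y 2 P) (hQ : MemLp Q 2 P) :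
    MemLp (fun ω => Q ω + 2 * (X ω * Y ω)) 2 P ∧
      ∫ ω, (Q ω + 2 * (X ω * Y ω)) ^ 2 ∂P = ∫ ω, Q ω ^ 2 ∂P + 4 * ∫ ω, Y ω ^ 2 ∂P := by
  have hX := memLp_two_of_integral_sq_eq_one hXm h2
  have i1 : IndepFun X (fun ω => Y ω * Q ω) P :=
    hind.comp measurable_id (measurable_fst.mul measurable_snd)
  have i2 : IndepFun (fun ω => X ω ^ 2) (fun ω => Y ω ^ 2) P :=
    hind.comp (φ := fun x : ℝ => x ^ 2) (ψ := fun q : ℝ × ℝ => q.1 ^ 2) (by fun_prop) (by fun_prop)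
  have hYQ : Integrable (fun ω => Y ω * Q ω) P := hY.integrable_mul hQ
  -- Independence makes these products integrable from second moments alone, so no fourth moments
  -- enter.
  have hXYQ : Integrable (fun ω => X ω * (Y ω * Q ω)) P :=
    i1.integrable_mul (hX.integrable (by norm_num)) hYQ
  have hX2Y2 : Integrable (fun ω => X ω ^ 2 * Y ω ^ 2) P :=
    i2.integrable_mul hX.integrable_sq hY.integrable_sq
  have hXY : MemLp (fun ω => X ω * Y ω) 2 P := by
    rw [memLp_two_iff_integrable_sq (f := fun ω => X ω * Y ω) (hX.1.mul hY.1)]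
    simpa [mul_pow] using hX2Y2
  refine ⟨hQ.add (hXY.const_mul 2), ?_⟩
  have e : ∀ ω, (Q ω + 2 * (X ω * Y ω)) ^ 2 =
      Q ω ^ 2 + (4 * (X ω * (Y ω * Q ω)) + 4 * (X ω ^ 2 * Y ω ^ 2)) := fun ω => by ring
  simp_rw [e]
  have hA : Integrable (fun ω => 4 * (X ω * (Y ω * Q ω)) + 4 * (X ω ^ 2 * Y ω ^ 2)) P :=
    (hXYQ.const_mul 4).add (hX2Y2.const_mul 4)
  rw [integral_add hQ.integrable_sq hA,
    integral_add (hXYQ.const_mul 4) (hX2Y2.const_mul 4), integral_const_mul, integral_const_mul,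
    i1.integral_fun_mul_eq_mul_integral hX.1 hYQ.1,
    i2.integral_fun_mul_eq_mul_integral hX.integrable_sq.1 hY.integrable_sq.1, h0, h2]
  ring

/-- The second moment of a quadratic form with zero diagonal in standardized variables. -/
theorem integral_sq_quadratic_of_standardized [IsFiniteMeasure P] (hm : ∀ j, Measurable (ξ j))
    (hi : iIndepFun ξ P) (h0 : ∀ j, ∫ ω, ξ j ω ∂P = 0) (h2 : ∀ j, ∫ ω, ξ j ω ^ 2 ∂P = 1)
    {A : ι → ι → ℝ} (hsymm : ∀ i j, A i j = A j i) (hdiag : ∀ i, A i i = 0) (s : Finset ι) :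
    MemLp (fun ω => ∑ i ∈ s, ∑ j ∈ s, A i j * (ξ i ω * ξ j ω)) 2 P ∧
      ∫ ω, (∑ i ∈ s, ∑ j ∈ s, A i j * (ξ i ω * ξ j ω)) ^ 2 ∂P =
        2 * ∑ i ∈ s, ∑ j ∈ s, A i j ^ 2 := by
  classical
  induction s using Finset.induction_on with
  | empty => simp
  | insert a s ha ih =>
    obtain ⟨ih1, ih2⟩ := ih
    have hY := memLp_linear_of_standardized (P := P) hm h2 (A a) s
    have hind : IndepFun (ξ a) (fun ω => (∑ j ∈ s, A a j * ξ j ω,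
        ∑ i ∈ s, ∑ j ∈ s, A i j * (ξ i ω * ξ j ω))) P := by
      have h := hi.indepFun_finset {a} s (Finset.disjoint_singleton_left.mpr ha) hm
      have h' := h.comp (φ := fun x : (({a} : Finset ι) → ℝ) => x ⟨a, Finset.mem_singleton_self a⟩)
        (ψ := fun x : (s → ℝ) => (∑ j : s, A a j * x j,
          ∑ i : s, ∑ j : s, A i j * (x i * x j)))
        (measurable_pi_apply (X := fun _ : ({a} : Finset ι) => ℝ) ⟨a, Finset.mem_singleton_self a⟩)
        (by fun_prop)
      refine h'.congr (EventuallyEq.refl _ _) (Eventually.of_forall fun ω => Prod.ext ?_ ?_)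
      · exact Finset.sum_coe_sort s fun j => A a j * ξ j ω
      · refine Eq.trans (Finset.sum_congr rfl fun i _ => ?_)
          (Finset.sum_coe_sort s fun i => ∑ j ∈ s, A i j * (ξ i ω * ξ j ω))
        exact Finset.sum_coe_sort s fun j => A i j * (ξ i ω * ξ j ω)
    obtain ⟨k1, k2⟩ := integral_sq_add_two_mul (hm a) hind (h0 a) (h2 a) hY ih1
    -- A new index adds 2 X Y, with X = ξ a independent of the linear form Y and of the old
    -- quadratic form; there is no X² term because the diagonal vanishes.
    have e : ∀ ω, ∑ i ∈ insert a s, ∑ j ∈ insert a s, A i j * (ξ i ω * ξ j ω) =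
        ∑ i ∈ s, ∑ j ∈ s, A i j * (ξ i ω * ξ j ω) + 2 * (ξ a ω * ∑ j ∈ s, A a j * ξ j ω) :=
      fun ω => by
        simp only [Finset.sum_insert ha, Finset.sum_add_distrib, hdiag]
        have e1 : ∑ i ∈ s, A i a * (ξ i ω * ξ a ω) = ξ a ω * ∑ j ∈ s, A a j * ξ j ω := by
          rw [Finset.mul_sum]
          exact Finset.sum_congr rfl fun i _ => by rw [hsymm i a]; ring
        have e2 : ∑ i ∈ s, A a i * (ξ a ω * ξ i ω) = ξ a ω * ∑ j ∈ s, A a j * ξ j ω := by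
          rw [Finset.mul_sum]
          exact Finset.sum_congr rfl fun i _ => by ring
        rw [e1, e2]
        ring
    simp_rw [e]
    refine ⟨k1, ?_⟩
    rw [k2, ih2, integral_sq_linear_of_standardized hm hi h0 h2]
    simp only [Finset.sum_insert ha, Finset.sum_add_distrib, hdiag]
    simp_rw [hsymm _ a]
    ring

end Orthonormal

/-- An upper tail bound for a sum of independent nonnegative variables with moments of order
`q ∈ (0, 2]`, by truncation at the level `M`. -/
theorem measureReal_sum_gt_le_of_moment [IsProbabilityMeasure P] {ι : Type*} [Fintype ι]
    {Z : ι → Ω → ℝ} (hm : ∀ j, Measurable (Z j)) (hi : iIndepFun Z P) (hZ : ∀ j ω, 0 ≤ Z j ω)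
    (hint : ∀ j, Integrable (Z j) P) {q : ℝ} (hq0 : 0 < q) (hq2 : q ≤ 2)
    (hq : ∀ j, Integrable (fun ω => Z j ω ^ q) P) {M : ℝ} (hM : 0 < M) :
    P.real {ω | ∑ j, ∫ ω, Z j ω ∂P + M < ∑ j, Z j ω} ≤
      2 * (∑ j, ∫ ω, Z j ω ^ q ∂P) / M ^ q := by
  have hMq : 0 < M ^ q := Real.rpow_pos_of_pos hM q
  set T : ι → Ω → ℝ := fun j ω => (Set.Iic M).indicator id (Z j ω) with hT
  have hφ : Measurable ((Set.Iic M).indicator (id : ℝ → ℝ)) :=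
    measurable_id.indicator measurableSet_Iic
  have hTm : ∀ j, Measurable (T j) := fun j => hφ.comp (hm j)
  have hT0 : ∀ j ω, 0 ≤ T j ω := fun j ω => by
    simp only [hT, Set.indicator]; split_ifs <;> simp [hZ]
  have hTM : ∀ j ω, T j ω ≤ M := fun j ω => by
    simp only [hT, Set.indicator]; split_ifs with h
    · exact h
    · exact hM.le
  have hTZ : ∀ j ω, T j ω ≤ Z j ω := fun j ω => by
    simp only [hT, Set.indicator]; split_ifs with h
    · simp
    · exact hZ j ω
  have hTi : iIndepFun T P := hi.comp _ fun _ => hφ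
  have hTL : ∀ j, MemLp (T j) 2 P := fun j =>
    MemLp.of_bound (hTm j).aestronglyMeasurable M (Eventually.of_forall fun ω => by
      rw [Real.norm_eq_abs, abs_of_nonneg (hT0 j ω)]; exact hTM j ω)
  -- Splitting the square as T^(2-q) T^q lets a moment of order q ≤ 2 control the variance after
  -- truncation.
  have hTsq : ∀ j ω, T j ω ^ 2 ≤ M ^ (2 - q) * Z j ω ^ q := fun j ω => by
    rcases (hT0 j ω).eq_or_lt with h | h
    · rw [← h]
      have := hZ j ω
      simp only [ne_eq, OfNat.ofNat_ne_zero, not_false_eq_true, zero_pow]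
      positivity
    · calc T j ω ^ 2 = T j ω ^ (2 - q) * T j ω ^ q := by
            rw [← Real.rpow_add h]; norm_num
        _ ≤ M ^ (2 - q) * Z j ω ^ q := by
            have h1 := Real.rpow_le_rpow h.le (hTM j ω) (sub_nonneg.mpr hq2)
            have h2 := Real.rpow_le_rpow h.le (hTZ j ω) hq0.le
            exact mul_le_mul h1 h2 (by positivity) (by positivity)
  have hvar : ∀ j, variance (T j) P ≤ M ^ (2 - q) * ∫ ω, Z j ω ^ q ∂P := fun j => by
    refine (variance_le_expectation_sq (hTm j).aestronglyMeasurable).trans ?_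
    rw [← integral_const_mul]
    exact integral_mono (hTL j).integrable_sq ((hq j).const_mul _) fun ω => hTsq j ω
  have hvsum : variance (∑ j, T j) P ≤ M ^ (2 - q) * ∑ j, ∫ ω, Z j ω ^ q ∂P := by
    rw [IndepFun.variance_sum (fun j _ => hTL j) fun i _ j _ hij => hTi.indepFun hij,
      Finset.mul_sum]
    exact Finset.sum_le_sum fun j _ => hvar j
  have hmean : ∫ ω, (∑ j, T j) ω ∂P ≤ ∑ j, ∫ ω, Z j ω ∂P := by
    simp only [Finset.sum_apply]
    rw [integral_finsetSum _ fun j _ => (hTL j).integrable (by norm_num)]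
    exact Finset.sum_le_sum fun j _ =>
      integral_mono ((hTL j).integrable (by norm_num)) (hint j) fun ω => hTZ j ω
  -- Either no variable exceeds M and truncation changes nothing, or one does. Chebyshev's and
  -- Markov's inequalities bound the two cases by the same quantity, whence the factor 2.
  have hsub : {ω | ∑ j, ∫ ω, Z j ω ∂P + M < ∑ j, Z j ω} ⊆
      {ω | M ≤ |(∑ j, T j) ω - ∫ ω, (∑ j, T j) ω ∂P|} ∪ ⋃ j, {ω | M ^ q < Z j ω ^ q} := by
    intro ω hω
    by_cases hall : ∀ j, Z j ω ≤ M
    · left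
      have e : ∀ j, T j ω = Z j ω := fun j => by
        simp only [hT]; rw [Set.indicator_of_mem (show Z j ω ∈ Set.Iic M from hall j)]; rfl
      have e2 : (∑ j, T j) ω = ∑ j, Z j ω := by simp [e]
      rw [Set.mem_ofPred_eq] at hω ⊢
      refine le_trans ?_ (le_abs_self _)
      rw [e2]
      linarith
    · right
      push Not at hall
      obtain ⟨j, hj⟩ := hall
      refine Set.mem_iUnion.mpr ⟨j, ?_⟩
      exact Real.rpow_lt_rpow hM.le hj hq0
  have hc := meas_ge_le_variance_div_sq (memLp_finsetSum' _ fun j _ => hTL j) hM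
    (X := ∑ j, T j)
  have hc' : P.real {ω | M ≤ |(∑ j, T j) ω - ∫ ω, (∑ j, T j) ω ∂P|} ≤
      (∑ j, ∫ ω, Z j ω ^ q ∂P) / M ^ q := by
    refine (ENNReal.toReal_le_of_le_ofReal
      (div_nonneg (variance_nonneg _ _) (sq_nonneg M)) hc).trans ?_
    refine (div_le_div_of_nonneg_right hvsum (sq_nonneg M)).trans (le_of_eq ?_)
    rw [Real.rpow_sub hM, Real.rpow_two]
    field_simp
  have hu : P.real (⋃ j, {ω | M ^ q < Z j ω ^ q}) ≤ (∑ j, ∫ ω, Z j ω ^ q ∂P) / M ^ q := by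
    rw [Finset.sum_div]
    refine (measureReal_iUnion_fintype_le _).trans (Finset.sum_le_sum fun j _ => ?_)
    exact measureReal_gt_le_integral_div (fun ω => Real.rpow_nonneg (hZ j ω) q) (hq j) hMq
  have := (measureReal_mono (μ := P) hsub (measure_ne_top _ _)).trans (measureReal_union_le _ _)
  rw [two_mul, add_div]
  linarith

end Concentration

/-! ### The quadratic form ξᵀSξ in high dimension -/

section QuadraticForm

variable {Ω : Type*} [MeasurableSpace Ω] {P : Measure Ω} [IsProbabilityMeasure P]
  {ι : Type*} [Fintype ι] {ξ : ι → Ω → ℝ} {S : Matrix ι ι ℝ}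

theorem frobNorm_nonneg (S : Matrix ι ι ℝ) : 0 ≤ frobNorm S := Real.sqrt_nonneg _

theorem frobNorm_sq (S : Matrix ι ι ℝ) : frobNorm S ^ 2 = ∑ a, ∑ b, S a b ^ 2 :=
  Real.sq_sqrt (Finset.sum_nonneg fun _ _ => Finset.sum_nonneg fun _ _ => sq_nonneg _)

/-- The upper tail of a positive semidefinite quadratic form in standardized variables with bounded
moments of order `r`. -/
theorem measureReal_quadratic_gt_le (hm : ∀ j, Measurable (ξ j)) (hi : iIndepFun ξ P)
    (h0 : ∀ j, ∫ ω, ξ j ω ∂P = 0) (h2 : ∀ j, ∫ ω, ξ j ω ^ 2 ∂P = 1) {r K : ℝ} (hr2 : 2 < r)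
    (hr4 : r ≤ 4) (hr : ∀ j, Integrable (fun ω => |ξ j ω| ^ r) P)
    (hK : ∀ j, ∫ ω, |ξ j ω| ^ r ∂P ≤ K) (hS : S.PosSemidef) (htr : 0 < S.trace) :
    P.real {ω | 3 * S.trace < ∑ i, ∑ j, S i j * (ξ i ω * ξ j ω)} ≤
      2 * (K * ∑ j, S j j ^ (r / 2)) / S.trace ^ (r / 2) +
        2 * frobNorm S ^ 2 / S.trace ^ 2 := by
  classical
  have hd : ∀ j, 0 ≤ S j j := fun j => hS.diag_nonneg
  set A : ι → ι → ℝ := fun i j => if i = j then 0 else S i j with hA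
  have hsym : ∀ i j, A i j = A j i := fun i j => by
    have := hS.1.apply i j
    simp only [star_trivial] at this
    simp only [hA, eq_comm (a := i), this]
  obtain ⟨hoL, ho⟩ := integral_sq_quadratic_of_standardized (P := P) hm hi h0 h2 hsym
    (fun i => by simp [hA]) Finset.univ
  set Q : Ω → ℝ := fun ω => ∑ i, ∑ j, A i j * (ξ i ω * ξ j ω) with hQ
  set Z : ι → Ω → ℝ := fun j ω => S j j * ξ j ω ^ 2 with hZ
  have hsplit : ∀ ω, ∑ i, ∑ j, S i j * (ξ i ω * ξ j ω) = ∑ j, Z j ω + Q ω := fun ω => by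
    simp only [hQ, hZ, ← Finset.sum_add_distrib]
    refine Finset.sum_congr rfl fun i _ => ?_
    rw [← Finset.add_sum_erase _ _ (Finset.mem_univ i),
      ← Finset.add_sum_erase (f := fun j => A i j * (ξ i ω * ξ j ω)) _ (Finset.mem_univ i)]
    have : ∀ j ∈ Finset.univ.erase i, S i j * (ξ i ω * ξ j ω) = A i j * (ξ i ω * ξ j ω) :=
      fun j hj => by simp [hA, (Finset.ne_of_mem_erase hj).symm]
    rw [Finset.sum_congr rfl this]
    simp [hA, sq]
  have hZint : ∀ j, ∫ ω, Z j ω ∂P = S j j := fun j => by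
    simp only [hZ, integral_const_mul, h2, mul_one]
  have hpow : ∀ j ω, Z j ω ^ (r / 2) = S j j ^ (r / 2) * |ξ j ω| ^ r := fun j ω => by
    simp only [hZ]
    rw [Real.mul_rpow (hd j) (sq_nonneg _), ← sq_abs, ← Real.rpow_natCast,
      ← Real.rpow_mul (abs_nonneg _)]
    congr 2
    push_cast; ring
  have hdiag := measureReal_sum_gt_le_of_moment (P := P) (Z := Z) (q := r / 2) (M := S.trace)
    (fun j => ((hm j).pow_const 2).const_mul _)
    (hi.comp (fun j x => S j j * x ^ 2) fun j => by fun_prop)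
    (fun j ω => mul_nonneg (hd j) (sq_nonneg _))
    (fun j => (memLp_two_of_integral_sq_eq_one (hm j) (h2 j)).integrable_sq.const_mul _)
    (by linarith) (by linarith)
    (fun j => by simp_rw [hpow]; exact (hr j).const_mul _) htr
  have hmom : ∑ j, ∫ ω, Z j ω ^ (r / 2) ∂P ≤ K * ∑ j, S j j ^ (r / 2) := by
    rw [Finset.mul_sum]
    refine Finset.sum_le_sum fun j _ => ?_
    simp_rw [hpow, integral_const_mul]
    rw [mul_comm K]
    exact mul_le_mul_of_nonneg_left (hK j) (Real.rpow_nonneg (hd j) _)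
  have hoff : P.real {ω | S.trace ^ 2 < Q ω ^ 2} ≤ 2 * frobNorm S ^ 2 / S.trace ^ 2 := by
    refine (measureReal_gt_le_integral_div (fun ω => sq_nonneg (Q ω)) hoL.integrable_sq
      (by positivity)).trans ?_
    gcongr
    rw [ho, frobNorm_sq]
    refine mul_le_mul_of_nonneg_left (Finset.sum_le_sum fun i _ => Finset.sum_le_sum fun j _ => ?_)
      zero_le_two
    simp only [hA]
    split_ifs
    · simpa using sq_nonneg (S i j)
    · exact le_rfl
  -- The three traces are the mean of the diagonal part, its allowed deviation and the allowed
  -- off-diagonal part.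
  have hsub : {ω | 3 * S.trace < ∑ i, ∑ j, S i j * (ξ i ω * ξ j ω)} ⊆
      {ω | ∑ j, ∫ ω, Z j ω ∂P + S.trace < ∑ j, Z j ω} ∪ {ω | S.trace ^ 2 < Q ω ^ 2} := by
    intro ω hω
    rw [Set.mem_ofPred_eq, hsplit] at hω
    by_cases h : S.trace < Q ω
    · right
      exact pow_lt_pow_left₀ h htr.le two_ne_zero
    · left
      rw [Set.mem_ofPred_eq]
      simp_rw [hZint]
      have : ∑ j, S j j = S.trace := rfl
      linarith
  refine (measureReal_mono hsub (measure_ne_top _ _)).trans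
    ((measureReal_union_le _ _).trans (add_le_add (hdiag.trans ?_) hoff))
  gcongr

/-- Power mean bound for the diagonal by the Frobenius norm. -/
theorem sum_diag_rpow_le {r : ℝ} (hr2 : 2 < r) (hr4 : r ≤ 4) (hd : ∀ j, 0 ≤ S j j) :
    ∑ j, S j j ^ (r / 2) ≤ (Fintype.card ι : ℝ) ^ (1 - r / 4) * frobNorm S ^ (r / 2) := by
  have hr0 : 0 < r := by linarith
  -- The exponent 4/r ≥ 1 turns the powers r/2 of the diagonal entries into squares.
  have h := Real.rpow_sum_le_const_mul_sum_rpow Finset.univ (fun j => S j j ^ (r / 2))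
    (p := 4 / r) (by rw [le_div_iff₀ hr0]; linarith)
  have e : ∀ j, |S j j ^ (r / 2)| = S j j ^ (r / 2) := fun j =>
    abs_of_nonneg (Real.rpow_nonneg (hd j) _)
  have e2 : ∀ j, (S j j ^ (r / 2)) ^ (4 / r) = S j j ^ 2 := fun j => by
    rw [← Real.rpow_mul (hd j), show r / 2 * (4 / r) = 2 by field_simp; norm_num, Real.rpow_two]
  simp_rw [e, e2, Finset.card_univ] at h
  have hs : 0 ≤ ∑ j, S j j ^ (r / 2) := Finset.sum_nonneg fun j _ => Real.rpow_nonneg (hd j) _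
  have hle : ∑ j, S j j ^ 2 ≤ frobNorm S ^ 2 := by
    rw [frobNorm_sq]
    exact Finset.sum_le_sum fun j _ =>
      Finset.single_le_sum (f := fun b => S j b ^ 2) (fun _ _ => sq_nonneg _) (Finset.mem_univ j)
  have hc : (0 : ℝ) ≤ (Fintype.card ι : ℝ) ^ (4 / r - 1) := by positivity
  have h3 := h.trans (mul_le_mul_of_nonneg_left hle hc)
  have h4 := Real.rpow_le_rpow (Real.rpow_nonneg hs _) h3 (show 0 ≤ r / 4 by positivity)
  rw [← Real.rpow_mul hs, show 4 / r * (r / 4) = 1 by field_simp, Real.rpow_one,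
    Real.mul_rpow hc (sq_nonneg _), ← Real.rpow_mul (by positivity), ← Real.rpow_two,
    ← Real.rpow_mul (frobNorm_nonneg S)] at h4
  convert h4 using 3
  · field_simp
  · ring

/-- In high dimension, the quadratic form exceeds three times its mean with small probability. -/
theorem measureReal_quadratic_gt_le_of_highDim (hm : ∀ j, Measurable (ξ j)) (hi : iIndepFun ξ P)
    (h0 : ∀ j, ∫ ω, ξ j ω ∂P = 0) (h2 : ∀ j, ∫ ω, ξ j ω ^ 2 ∂P = 1) {r K : ℝ} (hr2 : 2 < r)
    (hr4 : r ≤ 4) (hr : ∀ j, Integrable (fun ω => |ξ j ω| ^ r) P)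
    (hK : ∀ j, ∫ ω, |ξ j ω| ^ r ∂P ≤ K) (hS : S.PosSemidef) (htr : 0 < S.trace)
    {N : ℝ} (hN : 1 ≤ N)
    (hdim : 2 * (2 * (1 + |K|)) * N ^ (2 / r) * (Fintype.card ι : ℝ) ^ (2 / r - 1 / 2) *
      frobNorm S ≤ S.trace) :
    P.real {ω | 3 * S.trace < ∑ i, ∑ j, S i j * (ξ i ω * ξ j ω)} ≤ N⁻¹ := by
  have hd : ∀ j, 0 ≤ S j j := fun j => hS.diag_nonneg
  have hr0 : 0 < r := by linarith
  have hN0 : 0 < N := by linarith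
  have hF := frobNorm_nonneg S
  have hK0 := abs_nonneg K
  have hne : Nonempty ι := by
    by_contra h
    rw [not_nonempty_iff] at h
    simp [Matrix.trace] at htr
  have hcard : (1 : ℝ) ≤ Fintype.card ι := by exact_mod_cast Fintype.card_pos
  refine (measureReal_quadratic_gt_le hm hi h0 h2 hr2 hr4 hr hK hS htr).trans ?_
  set c : ℝ := 2 * (2 * (1 + |K|)) with hc
  have hc1 : 1 ≤ c := by linarith
  have htrq : 0 < S.trace ^ (r / 2) := Real.rpow_pos_of_pos htr _
  have hfirst : 2 * (K * ∑ j, S j j ^ (r / 2)) / S.trace ^ (r / 2) ≤ N⁻¹ / 2 := by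
    have hs : 0 ≤ ∑ j, S j j ^ (r / 2) := Finset.sum_nonneg fun j _ => Real.rpow_nonneg (hd j) _
    -- Raised to the power r/2, the dimension condition contains N itself and exactly the power-mean
    -- bound for the diagonal.
    have h1 := Real.rpow_le_rpow (by positivity) hdim (show 0 ≤ r / 2 by positivity)
    rw [Real.mul_rpow (by positivity) hF, Real.mul_rpow (by positivity) (by positivity),
      Real.mul_rpow (by positivity) (by positivity), ← Real.rpow_mul hN0.le,
      ← Real.rpow_mul (by positivity), show 2 / r * (r / 2) = 1 by field_simp, Real.rpow_one,
      show (2 / r - 1 / 2) * (r / 2) = 1 - r / 4 by field_simp; ring] at h1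
    have h2 : c ≤ c ^ (r / 2) := Real.self_le_rpow_of_one_le hc1 (by linarith)
    have h3 : c * N * ∑ j, S j j ^ (r / 2) ≤ S.trace ^ (r / 2) := by
      refine le_trans ?_ h1
      rw [mul_assoc (c ^ (r / 2) * N)]
      have := sum_diag_rpow_le hr2 hr4 hd
      gcongr
    rw [div_le_iff₀ htrq]
    have h4 : N⁻¹ / 2 * (c * N * ∑ j, S j j ^ (r / 2)) ≤ N⁻¹ / 2 * S.trace ^ (r / 2) := by gcongr
    have h5 : N⁻¹ / 2 * (c * N * ∑ j, S j j ^ (r / 2)) = c / 2 * ∑ j, S j j ^ (r / 2) := by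
      field_simp
    have h6 : 2 * K ≤ c / 2 := by linarith [le_abs_self K]
    have h7 := mul_le_mul_of_nonneg_right h6 hs
    linarith
  have hsecond : 2 * frobNorm S ^ 2 / S.trace ^ 2 ≤ N⁻¹ / 2 := by
    have h1 : (1 : ℝ) ≤ (Fintype.card ι : ℝ) ^ (2 / r - 1 / 2) := by
      refine Real.one_le_rpow hcard ?_
      rw [sub_nonneg, div_le_div_iff₀ (by norm_num) hr0]
      linarith
    -- As r ≤ 4, the condition also gives the factor √N that Chebyshev's inequality needs off the
    -- diagonal.
    have h2 : N ^ (1 / 2 : ℝ) ≤ N ^ (2 / r) := by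
      refine Real.rpow_le_rpow_of_exponent_le hN ?_
      rw [div_le_div_iff₀ (by norm_num) hr0]
      linarith
    have hsN : (N ^ (1 / 2 : ℝ)) ^ 2 = N := by
      rw [← Real.rpow_natCast, ← Real.rpow_mul hN0.le]; norm_num
    have h3 : 2 * N ^ (1 / 2 : ℝ) * 1 * frobNorm S ≤ S.trace := by
      refine le_trans ?_ hdim
      gcongr
      linarith
    have h4 : (2 * N ^ (1 / 2 : ℝ) * 1 * frobNorm S) ^ 2 ≤ S.trace ^ 2 := by gcongr
    rw [mul_one, mul_pow, mul_pow, hsN] at h4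
    rw [div_le_iff₀ (by positivity)]
    have h5 : N⁻¹ / 2 * (2 ^ 2 * N * frobNorm S ^ 2) ≤ N⁻¹ / 2 * S.trace ^ 2 := by gcongr
    have h6 : N⁻¹ / 2 * (2 ^ 2 * N * frobNorm S ^ 2) = 2 * frobNorm S ^ 2 := by
      field_simp
    linarith
  linarith

end QuadraticForm

/-! ### Extended vectors and their second moments -/

section Extended

variable {p : ℕ}

theorem inner_extendVec (u v : EuclideanSpace ℝ (Fin p)) (a b : ℝ) :
    ⟪extendVec u a, extendVec v b⟫ = ⟪u, v⟫ + a * b := by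
  simp [extendVec, PiLp.inner_apply, Fintype.sum_sum_type, mul_comm]

theorem norm_extendVec_sq (v : EuclideanSpace ℝ (Fin p)) (b : ℝ) :
    ‖extendVec v b‖ ^ 2 = ‖v‖ ^ 2 + b ^ 2 := by
  rw [← real_inner_self_eq_norm_sq, inner_extendVec, real_inner_self_eq_norm_sq, sq b]

theorem norm_extendVec_zero (v : EuclideanSpace ℝ (Fin p)) : ‖extendVec v 0‖ = ‖v‖ := by
  have := norm_extendVec_sq v 0
  rw [← sq_eq_sq₀ (norm_nonneg _) (norm_nonneg _), this]
  ring

theorem norm_extendVec_le (v : EuclideanSpace ℝ (Fin p)) {b : ℝ} (hb : 0 ≤ b) :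
    ‖extendVec v b‖ ≤ ‖v‖ + b := by
  refine (sq_le_sq₀ (norm_nonneg _) (by positivity)).mp ?_
  rw [norm_extendVec_sq]
  nlinarith [norm_nonneg v]

theorem exists_eq_extendVec (w : EuclideanSpace ℝ (Fin p ⊕ Unit)) :
    ∃ v b, w = extendVec v b :=
  ⟨WithLp.toLp 2 fun j => w (Sum.inl j), w (Sum.inr ()), by
    ext (j | j) <;> simp [extendVec]⟩

theorem toEuclideanCLM_fromBlocks_extendVec (S : Matrix (Fin p) (Fin p) ℝ)
    (v : EuclideanSpace ℝ (Fin p)) (b : ℝ) :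
    Matrix.toEuclideanCLM (n := Fin p ⊕ Unit) (𝕜 := ℝ) (Matrix.fromBlocks S 0 0 1)
      (extendVec v b) = extendVec (Matrix.toEuclideanCLM (n := Fin p) (𝕜 := ℝ) S v) b := by
  ext (j | j) <;>
    simp [extendVec, Matrix.ofLp_toEuclideanCLM, Matrix.fromBlocks_mulVec, Matrix.mulVec,
      dotProduct]

/-- The spectral norm of the extension of a matrix by a one. -/
theorem specNorm_fromBlocks_one (S : Matrix (Fin p) (Fin p) ℝ) :
    specNorm (Matrix.fromBlocks S 0 0 (1 : Matrix Unit Unit ℝ)) = max (specNorm S) 1 := by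
  apply le_antisymm
  · refine ContinuousLinearMap.opNorm_le_bound _ (by positivity) fun w => ?_
    obtain ⟨v, b, rfl⟩ := exists_eq_extendVec w
    rw [toEuclideanCLM_fromBlocks_extendVec]
    refine (sq_le_sq₀ (norm_nonneg _) (by positivity)).mp ?_
    rw [mul_pow, norm_extendVec_sq, norm_extendVec_sq, mul_add]
    have h1 : ‖Matrix.toEuclideanCLM (n := Fin p) (𝕜 := ℝ) S v‖ ≤ max (specNorm S) 1 * ‖v‖ :=
      (ContinuousLinearMap.le_opNorm _ v).trans (by gcongr; exact le_max_left _ _)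
    have h2 : (1 : ℝ) ≤ max (specNorm S) 1 ^ 2 := one_le_pow₀ (le_max_right _ _)
    have h3 := pow_le_pow_left₀ (norm_nonneg _) h1 2
    rw [mul_pow] at h3
    nlinarith [sq_nonneg b]
  · refine max_le ?_ ?_
    · refine ContinuousLinearMap.opNorm_le_bound _ (norm_nonneg _) fun v => ?_
      have := ContinuousLinearMap.le_opNorm (Matrix.toEuclideanCLM (n := Fin p ⊕ Unit) (𝕜 := ℝ)
        (Matrix.fromBlocks S 0 0 1)) (extendVec v 0)
      rwa [toEuclideanCLM_fromBlocks_extendVec, norm_extendVec_zero, norm_extendVec_zero] at this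
    · have := ContinuousLinearMap.le_opNorm (Matrix.toEuclideanCLM (n := Fin p ⊕ Unit) (𝕜 := ℝ)
        (Matrix.fromBlocks S 0 0 1)) (extendVec 0 1)
      have e : ‖extendVec (0 : EuclideanSpace ℝ (Fin p)) 1‖ = 1 := by
        rw [← sq_eq_sq₀ (norm_nonneg _) zero_le_one, norm_extendVec_sq]
        simp
      rwa [toEuclideanCLM_fromBlocks_extendVec, map_zero, e, mul_one] at this

/-- The signed extended feature splits into signal and noise. -/
theorem smul_extendVec_eq {y : ℝ} (hy : y = 1 ∨ y = -1) (μ z : EuclideanSpace ℝ (Fin p)) :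
    y • extendVec (y • μ + z) 1 = extendVec μ 0 + y • extendVec z 1 := by
  have hy2 : y * y = 1 := by rcases hy with rfl | rfl <;> norm_num
  ext (j | j)
  · simp [extendVec, mul_add, ← mul_assoc, hy2]
  · simp [extendVec]

end Extended

section SecondMoment

variable {Ω : Type*} [MeasurableSpace Ω] {P : Measure Ω}

/-- Chebyshev's inequality for a linear functional, in terms of the second moment matrix. -/
theorem integral_inner_sq_le {ι : Type*} [Fintype ι] [DecidableEq ι]
    {u : Ω → EuclideanSpace ℝ ι} (hu : ∀ a b, Integrable (fun ω => u ω a * u ω b) P)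
    (w : EuclideanSpace ℝ ι) :
    Integrable (fun ω => ⟪w, u ω⟫ ^ 2) P ∧
      ∫ ω, ⟪w, u ω⟫ ^ 2 ∂P ≤ specNorm (secondMoment P u) * ‖w‖ ^ 2 := by
  have e : ∀ ω, ⟪w, u ω⟫ ^ 2 = ∑ a, ∑ b, w a * w b * (u ω a * u ω b) := fun ω => by
    rw [PiLp.inner_apply, sq, Finset.sum_mul_sum]
    refine Finset.sum_congr rfl fun a _ => Finset.sum_congr rfl fun b _ => ?_
    simp
    ring
  simp_rw [e]
  refine ⟨integrable_finsetSum _ fun a _ => integrable_finsetSum _ fun b _ =>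
    (hu a b).const_mul _, ?_⟩
  rw [integral_finsetSum _ fun a _ => integrable_finsetSum _ fun b _ => (hu a b).const_mul _]
  have e2 : ∀ a, ∫ ω, ∑ b, w a * w b * (u ω a * u ω b) ∂P =
      w a * ∑ b, secondMoment P u a b * w b := fun a => by
    rw [integral_finsetSum _ fun b _ => (hu a b).const_mul _, Finset.mul_sum]
    refine Finset.sum_congr rfl fun b _ => ?_
    rw [integral_const_mul, secondMoment, Matrix.of_apply]
    ring
  simp_rw [e2]
  have e3 : ∑ a, w a * ∑ b, secondMoment P u a b * w b =
      ⟪w, Matrix.toEuclideanCLM (n := ι) (𝕜 := ℝ) (secondMoment P u) w⟫ := by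
    simp [PiLp.inner_apply, Matrix.ofLp_toEuclideanCLM, Matrix.mulVec, dotProduct, mul_comm]
  rw [e3]
  refine (real_inner_le_norm _ _).trans ?_
  have := ContinuousLinearMap.le_opNorm (Matrix.toEuclideanCLM (n := ι) (𝕜 := ℝ)
    (secondMoment P u)) w
  rw [specNorm]
  nlinarith [norm_nonneg w]

end SecondMoment

/-! ### The noise vector -/

section Noise

variable {Ω : Type*} {p : ℕ} {S : Matrix (Fin p) (Fin p) ℝ} {g : Ω → ℝ} {ξ : Fin p → Ω → ℝ}

theorem sqrt_mul_sqrt_apply (hS : S.PosSemidef) (a b : Fin p) :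
    ∑ j, CFC.sqrt S a j * CFC.sqrt S b j = S a b := by
  have h1 : CFC.sqrt S * CFC.sqrt S = S := CFC.sqrt_mul_sqrt_self S hS.nonneg
  have h2 : (CFC.sqrt S).PosSemidef := Matrix.nonneg_iff_posSemidef.mp (CFC.sqrt_nonneg S)
  conv_rhs => rw [← h1, Matrix.mul_apply]
  refine Finset.sum_congr rfl fun j _ => ?_
  have := h2.1.apply b j
  simp only [star_trivial] at this
  rw [this]

theorem noise_apply (ω : Ω) (a : Fin p) :
    noise S g ξ ω a = g ω * ∑ j, CFC.sqrt S a j * ξ j ω := by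
  simp [noise, Matrix.mulVec, dotProduct]

/-- The square root is symmetric with square S, so only S itself enters the norm. -/
theorem norm_noise_sq (hS : S.PosSemidef) (ω : Ω) :
    ‖noise S g ξ ω‖ ^ 2 = g ω ^ 2 * ∑ i, ∑ j, S i j * (ξ i ω * ξ j ω) := by
  have h2 : (CFC.sqrt S).PosSemidef := Matrix.nonneg_iff_posSemidef.mp (CFC.sqrt_nonneg S)
  have hs : ∀ a b, CFC.sqrt S a b = CFC.sqrt S b a := fun a b => by
    simpa using h2.1.apply b a
  rw [EuclideanSpace.norm_sq_eq]
  simp_rw [noise_apply, Real.norm_eq_abs, sq_abs, mul_pow]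
  rw [← Finset.mul_sum]
  congr 1
  simp_rw [← sqrt_mul_sqrt_apply hS, sq, Finset.sum_mul_sum, Finset.sum_mul]
  rw [Finset.sum_comm]
  refine Finset.sum_congr rfl fun i _ => ?_
  rw [Finset.sum_comm]
  refine Finset.sum_congr rfl fun j _ => Finset.sum_congr rfl fun a _ => ?_
  rw [hs i a, hs j a]
  ring

end Noise

/-- The set of pairs (feature, label) with label `±1` and noise at most `ρ`. -/
def lowNoiseSet {p : ℕ} (μ : EuclideanSpace ℝ (Fin p)) (ρ : ℝ) :
    Set (EuclideanSpace ℝ (Fin p) × ℝ) :=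
  {q | (q.2 = 1 ∨ q.2 = -1) ∧ ‖q.1 - q.2 • μ‖ ≤ ρ}

/-- The set depends on the pair alone, so with measurability its probability transfers to each
sample point by equality in distribution. -/
theorem measurableSet_lowNoiseSet {p : ℕ} (μ : EuclideanSpace ℝ (Fin p)) (ρ : ℝ) :
    MeasurableSet (lowNoiseSet μ ρ) := by
  have h1 : IsClosed {q : EuclideanSpace ℝ (Fin p) × ℝ | q.2 = 1 ∨ q.2 = -1} :=
    (isClosed_eq continuous_snd continuous_const).union (isClosed_eq continuous_snd continuous_const)
  have h2 : IsClosed {q : EuclideanSpace ℝ (Fin p) × ℝ | ‖q.1 - q.2 • μ‖ ≤ ρ} :=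
    isClosed_le (by fun_prop) continuous_const
  exact (h1.inter h2).measurableSet

/-! ### Probability estimates in the mixture model -/

namespace ModelEM

variable {Ω : Type*} [MeasurableSpace Ω] {P : Measure Ω} {p : ℕ}
  {S : Matrix (Fin p) (Fin p) ℝ} {η r K k : ℝ} {l : ℝ≥0∞} {y yN g : Ω → ℝ} {ξ : Fin p → Ω → ℝ}

theorem ae_label [IsProbabilityMeasure P] (h : ModelEM P S η r K k l y yN g ξ) :
    ∀ᵐ ω ∂P, y ω = 1 ∨ y ω = -1 := by
  have m1 : MeasurableSet {ω | y ω = 1} := h.measurable_y (measurableSet_singleton 1)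
  have m2 : MeasurableSet {ω | y ω = -1} := h.measurable_y (measurableSet_singleton (-1))
  have hd : Disjoint {ω | y ω = 1} {ω | y ω = -1} := by
    rw [Set.disjoint_left]
    intro ω h1 h2
    rw [Set.mem_ofPred_eq] at h1 h2
    norm_num [h1] at h2
  have h1 : P ({ω | y ω = 1} ∪ {ω | y ω = -1}) = 1 := by
    rw [measure_union hd m2, h.y_pos, h.y_neg, ENNReal.add_halves]
  exact (prob_compl_eq_zero_iff (m1.union m2)).mpr h1

theorem ae_label_clean [IsProbabilityMeasure P] (h : ModelEM P S 0 r K k l y yN g ξ) :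
    ∀ᵐ ω ∂P, yN ω = y ω := by
  have m : MeasurableSet {ω | yN ω = y ω} := measurableSet_eq_fun h.measurable_yN h.measurable_y
  refine (prob_compl_eq_zero_iff m).mpr ?_
  simpa using h.yN_clean

theorem integrable_linear_mul_linear (h : ModelEM P S η r K k l y yN g ξ) (a b : Fin p → ℝ) :
    Integrable (fun ω => (∑ j, a j * ξ j ω) * ∑ j, b j * ξ j ω) P :=
  (memLp_linear_of_standardized h.measurable_ξ h.ξ_sq a _).integrable_mul
    (memLp_linear_of_standardized h.measurable_ξ h.ξ_sq b _)

theorem integral_linear_mul_linear (h : ModelEM P S η r K k l y yN g ξ) (a b : Fin p → ℝ) :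
    ∫ ω, (∑ j, a j * ξ j ω) * ∑ j, b j * ξ j ω ∂P = ∑ j, a j * b j := by
  have hint := integrable_mul_of_standardized (P := P) h.measurable_ξ h.ξ_sq
  have e : ∀ ω, (∑ j, a j * ξ j ω) * ∑ j, b j * ξ j ω =
      ∑ i, ∑ j, a i * b j * (ξ i ω * ξ j ω) := fun ω => by
    rw [Finset.sum_mul_sum]
    exact Finset.sum_congr rfl fun i _ => Finset.sum_congr rfl fun j _ => by ring
  simp_rw [e]
  rw [integral_finsetSum _ fun i _ => integrable_finsetSum _ fun j _ => (hint i j).const_mul _]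
  refine Finset.sum_congr rfl fun i _ => ?_
  rw [integral_finsetSum _ fun j _ => (hint i j).const_mul _]
  simp_rw [integral_const_mul, integral_mul_of_standardized h.measurable_ξ h.ξ_indep h.ξ_mean
    h.ξ_sq]
  simp

/-- The radial factor is independent of the direction and E g² = 1, so it disappears from the
covariance. -/
theorem noise_mul (h : ModelEM P S η r K k l y yN g ξ) (a b : Fin p) :
    Integrable (fun ω => noise S g ξ ω a * noise S g ξ ω b) P ∧
      ∫ ω, noise S g ξ ω a * noise S g ξ ω b ∂P = S a b := by
  have hg : Integrable (fun ω => g ω ^ 2) P := integrable_of_integral_eq_one h.g_sq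
  have hq := h.integrable_linear_mul_linear (CFC.sqrt S a) (CFC.sqrt S b)
  have hind : IndepFun (fun ω => g ω ^ 2)
      (fun ω => (∑ j, CFC.sqrt S a j * ξ j ω) * ∑ j, CFC.sqrt S b j * ξ j ω) P :=
    h.ξ_indep_g.symm.comp (φ := fun x : ℝ => x ^ 2)
      (ψ := fun v : Fin p → ℝ => (∑ j, CFC.sqrt S a j * v j) * ∑ j, CFC.sqrt S b j * v j)
      (by fun_prop) (by fun_prop)
  have e : ∀ ω, noise S g ξ ω a * noise S g ξ ω b =
      g ω ^ 2 * ((∑ j, CFC.sqrt S a j * ξ j ω) * ∑ j, CFC.sqrt S b j * ξ j ω) := fun ω => by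
    rw [noise_apply, noise_apply]; ring
  simp_rw [e]
  refine ⟨hind.integrable_mul hg hq, ?_⟩
  rw [hind.integral_fun_mul_eq_mul_integral hg.1 hq.1, h.g_sq, h.integral_linear_mul_linear,
    sqrt_mul_sqrt_apply h.posSemidef, one_mul]

theorem integral_noise [IsProbabilityMeasure P] (h : ModelEM P S η r K k l y yN g ξ) (a : Fin p) :
    Integrable (fun ω => noise S g ξ ω a) P ∧ ∫ ω, noise S g ξ ω a ∂P = 0 := by
  have hg : Integrable g P :=
    (memLp_two_of_integral_sq_eq_one h.measurable_g h.g_sq).integrable (by norm_num)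
  have hξ : ∀ j, Integrable (ξ j) P := fun j =>
    (memLp_two_of_integral_sq_eq_one (h.measurable_ξ j) (h.ξ_sq j)).integrable (by norm_num)
  have hq : Integrable (fun ω => ∑ j, CFC.sqrt S a j * ξ j ω) P :=
    integrable_finsetSum _ fun j _ => (hξ j).const_mul _
  have hind : IndepFun g (fun ω => ∑ j, CFC.sqrt S a j * ξ j ω) P :=
    h.ξ_indep_g.symm.comp (ψ := fun v : Fin p → ℝ => ∑ j, CFC.sqrt S a j * v j) measurable_id
      (by fun_prop)
  simp_rw [noise_apply]
  refine ⟨hind.integrable_mul hg hq, ?_⟩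
  rw [hind.integral_fun_mul_eq_mul_integral hg.1 hq.1,
    integral_finsetSum _ fun j _ => (hξ j).const_mul _]
  simp_rw [integral_const_mul, h.ξ_mean]
  simp

theorem integrable_extendVec_noise [IsProbabilityMeasure P]
    (h : ModelEM P S η r K k l y yN g ξ) (a b : Fin p ⊕ Unit) :
    Integrable (fun ω => extendVec (noise S g ξ ω) 1 a * extendVec (noise S g ξ ω) 1 b) P := by
  rcases a with a | a <;> rcases b with b | b <;> simp only [extendVec, Sum.elim_inl, Sum.elim_inr]
  · exact (h.noise_mul a b).1
  · simpa using (h.integral_noise a).1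
  · simpa using (h.integral_noise b).1
  · simp

/-- The off-diagonal blocks are means of the noise, which vanish. -/
theorem secondMoment_extendVec_noise [IsProbabilityMeasure P]
    (h : ModelEM P S η r K k l y yN g ξ) :
    secondMoment P (fun ω => extendVec (noise S g ξ ω) 1) = Matrix.fromBlocks S 0 0 1 := by
  ext a b
  rcases a with a | a <;> rcases b with b | b <;>
    simp only [secondMoment, Matrix.of_apply, extendVec, Sum.elim_inl, Sum.elim_inr]
  · exact (h.noise_mul a b).2
  · simpa using (h.integral_noise a).2
  · simpa using (h.integral_noise b).2
  · simp

/-- The radial factor exceeds `‖g‖_l N^(1/l)` with probability at most `1/N`. -/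
theorem measureReal_radial_gt_le [IsProbabilityMeasure P] (h : ModelEM P S η r K k l y yN g ξ)
    {N : ℝ} (hN : 0 < N) :
    P.real {ω | (eLpNorm g l P).toReal * N ^ (l⁻¹).toReal < g ω} ≤ N⁻¹ := by
  have hl0 : l ≠ 0 := (lt_of_lt_of_le (by norm_num) h.l_ge).ne'
  have hfin : eLpNorm g l P ≠ ∞ := h.g_memLp.2.ne
  -- At l = ∞ the exponent is 0 and the threshold is the essential supremum, exceeded with
  -- probability zero.
  rcases eq_or_ne l ∞ with rfl | hl
  · have h0 : P {ω | (eLpNorm g ∞ P).toReal * N ^ ((∞ : ℝ≥0∞)⁻¹).toReal < g ω} = 0 := by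
      have h1 : ∀ᵐ ω ∂P, ‖g ω‖ₑ ≤ eLpNorm g ∞ P := by
        rw [eLpNorm_exponent_top]
        exact ae_le_eLpNormEssSup
      rw [← compl_mem_ae_iff]
      filter_upwards [h1] with ω hω
      have h2 := ENNReal.toReal_mono hfin hω
      rw [toReal_enorm] at h2
      simp only [ENNReal.inv_top, ENNReal.toReal_zero, Real.rpow_zero, mul_one,
        Set.mem_compl_iff, Set.mem_ofPred_eq, not_lt]
      exact (Real.le_norm_self _).trans h2
    rw [Measure.real, h0, ENNReal.toReal_zero]
    positivity
  · have hlpos : 0 < l.toReal := ENNReal.toReal_pos hl0 hl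
    set G := (eLpNorm g l P).toReal with hG
    have hGpos : 0 < G := by
      refine ENNReal.toReal_pos (fun h0 => ?_) hfin
      rw [eLpNorm_eq_zero_iff h.g_memLp.1 hl0] at h0
      obtain ⟨ω, h1, h2⟩ := (h.g_pos.and h0).exists
      rw [h2] at h1
      exact lt_irrefl _ h1
    set t := G * N ^ (l⁻¹).toReal with ht
    have htpos : 0 < t := by positivity
    have hm := mul_meas_ge_le_pow_eLpNorm' P hl0 hl h.g_memLp.1 (ENNReal.ofReal t)
    have hm2 := ENNReal.toReal_mono (ENNReal.rpow_ne_top_of_nonneg hlpos.le hfin) hm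
    rw [ENNReal.toReal_mul, ← ENNReal.toReal_rpow, ← ENNReal.toReal_rpow,
      ENNReal.toReal_ofReal htpos.le, ← hG] at hm2
    have ht2 : t ^ l.toReal = G ^ l.toReal * N := by
      rw [ht, Real.mul_rpow hGpos.le (by positivity), ← Real.rpow_mul hN.le, ENNReal.toReal_inv,
        inv_mul_cancel₀ hlpos.ne', Real.rpow_one]
    have hGl : 0 < G ^ l.toReal := by positivity
    have hsub : P.real {ω | t < g ω} ≤ (P {ω | ENNReal.ofReal t ≤ ‖g ω‖ₑ}).toReal := by
      refine measureReal_mono (fun ω (hω : t < g ω) => ?_) (measure_ne_top _ _)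
      rw [Set.mem_ofPred_eq, ← ofReal_norm]
      exact ENNReal.ofReal_le_ofReal (hω.le.trans (Real.le_norm_self _))
    refine hsub.trans ?_
    rw [ht2, mul_assoc] at hm2
    have h5 : N * (P {ω | ENNReal.ofReal t ≤ ‖g ω‖ₑ}).toReal ≤ 1 := by
      refine le_of_mul_le_mul_left ?_ hGl
      rwa [mul_one]
    rw [← one_div, le_div_iff₀' hN]
    exact h5

/-- In high dimension, the quadratic form of the direction vector exceeds three times its mean with
probability at most `1/N`. -/
theorem measureReal_direction_gt_le [IsProbabilityMeasure P]
    (h : ModelEM P S η r K k l y yN g ξ) {N : ℝ} (hN : 1 ≤ N)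
    (hdim : 2 * (2 * (1 + |K|)) * N ^ (2 / r) * (p : ℝ) ^ (2 / r - 1 / 2) * frobNorm S ≤ S.trace) :
    P.real {ω | 3 * S.trace < ∑ i, ∑ j, S i j * (ξ i ω * ξ j ω)} ≤ N⁻¹ := by
  -- A vanishing trace forces S = 0 and an empty event; the tail bound itself needs a positive
  -- trace.
  rcases h.posSemidef.trace_nonneg.eq_or_lt with h0 | h0
  · have hS : S = 0 := h.posSemidef.trace_eq_zero_iff.mp h0.symm
    subst hS
    simp
    linarith
  · exact measureReal_quadratic_gt_le_of_highDim h.measurable_ξ h.ξ_indep h.ξ_mean h.ξ_sq h.r_mem.1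
      h.r_mem.2 h.ξ_integrable h.ξ_moment h.posSemidef h0 hN (by simpa using hdim)

/-- A pair (feature, label) has noise larger than `ρ` with probability at most `2/N`. -/
theorem measureReal_compl_lowNoiseSet_le [IsProbabilityMeasure P]
    (h : ModelEM P S 0 r K k l y yN g ξ) (μ : EuclideanSpace ℝ (Fin p)) {N : ℝ} (hN : 1 ≤ N)
    (hdim : 2 * (2 * (1 + |K|)) * N ^ (2 / r) * (p : ℝ) ^ (2 / r - 1 / 2) * frobNorm S ≤ S.trace)
    {ρ : ℝ} (hρ : 3 * Real.sqrt 2 / 2 * (eLpNorm g l P).toReal * N ^ (l⁻¹).toReal *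
      Real.sqrt S.trace ≤ ρ) :
    P.real ((fun ω => (feature μ S y g ξ ω, yN ω)) ⁻¹' (lowNoiseSet μ ρ)ᶜ) ≤ 2 * N⁻¹ := by
  set t := (eLpNorm g l P).toReal * N ^ (l⁻¹).toReal with ht
  have ht0 : 0 ≤ t := by positivity
  have htr := h.posSemidef.trace_nonneg
  have hsub : (fun ω => (feature μ S y g ξ ω, yN ω)) ⁻¹' (lowNoiseSet μ ρ)ᶜ ≤ᵐ[P]
      ({ω | t < g ω} ∪ {ω | 3 * S.trace < ∑ i, ∑ j, S i j * (ξ i ω * ξ j ω)} : Set Ω) := by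
    filter_upwards [h.ae_label, h.ae_label_clean, h.g_pos] with ω h1 h2 h3 h4
    by_contra hc
    have hc' : ¬ (t < g ω ∨ 3 * S.trace < ∑ i, ∑ j, S i j * (ξ i ω * ξ j ω)) := hc
    push Not at hc'
    refine h4 ⟨by simpa only [h2] using h1, ?_⟩
    have e : feature μ S y g ξ ω - yN ω • μ = noise S g ξ ω := by
      rw [feature, h2, add_sub_cancel_left]
    simp only [e]
    refine le_trans ?_ hρ
    refine (sq_le_sq₀ (norm_nonneg _) (by positivity)).mp ?_
    rw [norm_noise_sq h.posSemidef]
    -- Here (3√2/2)² = 9/2, which exceeds the factor 3 of the quadratic form.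
    have e2 : (3 * Real.sqrt 2 / 2 * (eLpNorm g l P).toReal * N ^ (l⁻¹).toReal *
        Real.sqrt S.trace) ^ 2 = t ^ 2 * (9 / 2 * S.trace) := by
      rw [ht]
      simp only [mul_pow, div_pow, Real.sq_sqrt htr, Real.sq_sqrt (zero_le_two (α := ℝ))]
      ring
    rw [e2]
    have h5 : g ω ^ 2 ≤ t ^ 2 := pow_le_pow_left₀ h3.le hc'.1 2
    calc g ω ^ 2 * ∑ i, ∑ j, S i j * (ξ i ω * ξ j ω) ≤ g ω ^ 2 * (9 / 2 * S.trace) := by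
          gcongr; linarith [hc'.2]
      _ ≤ t ^ 2 * (9 / 2 * S.trace) := by gcongr
  have h1 : P.real ((fun ω => (feature μ S y g ξ ω, yN ω)) ⁻¹' (lowNoiseSet μ ρ)ᶜ) ≤
      P.real ({ω | t < g ω} ∪ {ω | 3 * S.trace < ∑ i, ∑ j, S i j * (ξ i ω * ξ j ω)}) :=
    ENNReal.toReal_mono (measure_ne_top _ _) (measure_mono_ae hsub)
  refine h1.trans ((measureReal_union_le _ _).trans ?_)
  rw [two_mul]
  exact add_le_add (h.measureReal_radial_gt_le (by linarith)) (h.measureReal_direction_gt_le hN hdim)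

/-- The test error is bounded by Chebyshev's inequality. -/
theorem testError_le [IsProbabilityMeasure P] (h : ModelEM P S η r K k l y yN g ξ)
    (μ : EuclideanSpace ℝ (Fin p)) (w : EuclideanSpace ℝ (Fin p ⊕ Unit))
    (hw : 0 < ⟪w, extendVec μ 0⟫) :
    testError P (feature μ S y g ξ) y w ≤
      specNorm (secondMoment P fun ω => extendVec (noise S g ξ ω) 1) * ‖w‖ ^ 2 /
        ⟪w, extendVec μ 0⟫ ^ 2 := by
  obtain ⟨hi, hle⟩ := integral_inner_sq_le h.integrable_extendVec_noise w
  -- An error means that the signed noise outweighs the signal; squaring removes the sign, so label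
  -- and noise may be dependent.
  have hsub : ({ω | ⟪w, y ω • extendVec (feature μ S y g ξ ω) 1⟫ < 0} : Set Ω) ≤ᵐ[P]
      ({ω | ⟪w, extendVec μ 0⟫ ^ 2 < ⟪w, extendVec (noise S g ξ ω) 1⟫ ^ 2} : Set Ω) := by
    filter_upwards [h.ae_label] with ω h1 h2
    have h2' : ⟪w, y ω • extendVec (feature μ S y g ξ ω) 1⟫ < 0 := h2
    show ⟪w, extendVec μ 0⟫ ^ 2 < ⟪w, extendVec (noise S g ξ ω) 1⟫ ^ 2
    rw [feature, smul_extendVec_eq h1, inner_add_right, real_inner_smul_right] at h2'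
    have hy : y ω ^ 2 = 1 := by rcases h1 with h1 | h1 <;> rw [h1] <;> norm_num
    have h3 : ⟪w, extendVec (noise S g ξ ω) 1⟫ ^ 2 =
        (-(y ω * ⟪w, extendVec (noise S g ξ ω) 1⟫)) ^ 2 := by
      rw [neg_sq, mul_pow, hy, one_mul]
    rw [h3]
    exact pow_lt_pow_left₀ (by linarith) hw.le two_ne_zero
  have h1 : testError P (feature μ S y g ξ) y w ≤
      P.real {ω | ⟪w, extendVec μ 0⟫ ^ 2 < ⟪w, extendVec (noise S g ξ ω) 1⟫ ^ 2} :=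
    ENNReal.toReal_mono (measure_ne_top _ _) (measure_mono_ae hsub)
  refine h1.trans ((measureReal_gt_le_integral_div (fun ω => sq_nonneg _) hi
    (by positivity)).trans ?_)
  gcongr

end ModelEM

/-! ### Geometry of the maximum margin classifier for a large signal -/

section LargeSignal

variable {n p : ℕ} {μ : EuclideanSpace ℝ (Fin p)} {C : ℝ}
  {d : Fin n → EuclideanSpace ℝ (Fin p) × ℝ}

/-- The constant coordinate is counted with the noise; this produces the + 1 next to ‖μ‖/C below. -/
theorem mul_inner_extendVec_of_label (w : EuclideanSpace ℝ (Fin p ⊕ Unit))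
    (μ : EuclideanSpace ℝ (Fin p)) {q : EuclideanSpace ℝ (Fin p) × ℝ} (hq : q.2 = 1 ∨ q.2 = -1) :
    q.2 * ⟪w, extendVec q.1 1⟫ =
      ⟪w, extendVec μ 0⟫ + q.2 * ⟪w, extendVec (q.1 - q.2 • μ) 1⟫ := by
  have h := smul_extendVec_eq hq μ (q.1 - q.2 • μ)
  rw [add_sub_cancel] at h
  rw [← real_inner_smul_right, h, inner_add_right, real_inner_smul_right]

theorem neg_abs_le_label_mul {y : ℝ} (hy : y = 1 ∨ y = -1) (a : ℝ) : -|a| ≤ y * a := by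
  rcases hy with rfl | rfl
  · simpa using neg_abs_le a
  · simpa using le_abs_self a

/-- A suitable multiple of the signal satisfies all margin constraints. -/
theorem one_le_signal_margin (hμ : μ ≠ 0) (hC : 2 < C)
    (hd : ∀ i, d i ∈ lowNoiseSet μ (‖μ‖ / C)) (i : Fin n) :
    1 ≤ (d i).2 * ⟪(‖μ‖ ^ 2 * (1 - 1 / C))⁻¹ • extendVec μ 0, extendVec (d i).1 1⟫ := by
  obtain ⟨h1, h2⟩ := hd i
  have hμ0 : 0 < ‖μ‖ := norm_pos_iff.mpr hμ
  have hC1 : 0 < 1 - 1 / C := by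
    rw [sub_pos, div_lt_one (by linarith)]; linarith
  have hs : 0 < ‖μ‖ ^ 2 * (1 - 1 / C) := by positivity
  rw [real_inner_smul_left, mul_left_comm, le_inv_mul_iff₀ hs, mul_one,
    mul_inner_extendVec_of_label _ μ h1, real_inner_self_eq_norm_sq, norm_extendVec_zero,
    inner_extendVec, zero_mul, add_zero]
  have h3 := neg_abs_le_label_mul h1 ⟪μ, (d i).1 - (d i).2 • μ⟫
  have h4 : |⟪μ, (d i).1 - (d i).2 • μ⟫| ≤ ‖μ‖ * (‖μ‖ / C) :=
    (abs_real_inner_le_norm _ _).trans (by gcongr)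
  have h5 : ‖μ‖ ^ 2 * (1 - 1 / C) = ‖μ‖ ^ 2 - ‖μ‖ * (‖μ‖ / C) := by ring
  linarith

theorem exists_isMaxMargin (hμ : μ ≠ 0) (hC : 2 < C)
    (hd : ∀ i, d i ∈ lowNoiseSet μ (‖μ‖ / C)) : ∃ w, IsMaxMargin d w := by
  have hin : ∀ v i, ⟪v, (d i).2 • extendVec (d i).1 1⟫ = (d i).2 * ⟪v, extendVec (d i).1 1⟫ :=
    fun v i => real_inner_smul_right _ _ _
  obtain ⟨u, hu1, hu2⟩ := exists_minimal_norm (a := fun i => (d i).2 • extendVec (d i).1 1)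
    ⟨_, fun i => by rw [hin]; exact one_le_signal_margin hμ hC hd i⟩
  exact ⟨u, fun i => by rw [← hin]; exact hu1 i, fun v hv => hu2 v fun i => by rw [hin]; exact hv i⟩

/-- For a large signal, the maximum margin classifier is aligned with the signal. -/
theorem IsMaxMargin.norm_mul_le_inner {w : EuclideanSpace ℝ (Fin p ⊕ Unit)}
    (hw : IsMaxMargin d w) (hn : 0 < n) (hμ : μ ≠ 0) (hC : 2 < C)
    (hd : ∀ i, d i ∈ lowNoiseSet μ (‖μ‖ / C)) (hbig : 2 ≤ (1 / 2 - 1 / C) * ‖μ‖) :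
    w ≠ 0 ∧ (1 / 2 - 1 / C) * (‖w‖ * ‖μ‖) ≤ ⟪w, extendVec μ 0⟫ := by
  have hμ0 : 0 < ‖μ‖ := norm_pos_iff.mpr hμ
  have hC1 : 0 < 1 / 2 - 1 / C := by
    rw [sub_pos, div_lt_div_iff₀ (by linarith) (by norm_num)]; linarith
  have hs : 0 < ‖μ‖ ^ 2 * (1 - 1 / C) := mul_pos (by positivity) (by linarith)
  have hmargin := hw.1 ⟨0, hn⟩
  obtain ⟨h1, h2⟩ := hd ⟨0, hn⟩
  refine ⟨fun h0 => ?_, ?_⟩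
  · rw [h0, inner_zero_left, mul_zero] at hmargin
    linarith
  · set z := (d ⟨0, hn⟩).1 - (d ⟨0, hn⟩).2 • μ with hz
    have hnorm := hw.2 _ fun i => one_le_signal_margin hμ hC hd i
    rw [norm_smul, norm_inv, Real.norm_eq_abs, abs_of_pos hs, norm_extendVec_zero,
      le_inv_mul_iff₀ hs] at hnorm
    -- Minimality of w against the feasible multiple of the signal.
    have hX : (1 - 1 / C) * (‖w‖ * ‖μ‖) ≤ 1 := by
      refine le_of_mul_le_mul_left ?_ hμ0
      calc ‖μ‖ * ((1 - 1 / C) * (‖w‖ * ‖μ‖)) = ‖μ‖ ^ 2 * (1 - 1 / C) * ‖w‖ := by ring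
        _ ≤ ‖μ‖ * 1 := by rw [mul_one]; exact hnorm
    have hup : (d ⟨0, hn⟩).2 * ⟪w, extendVec z 1⟫ ≤ ‖w‖ * (‖μ‖ / C + 1) := by
      have h3 := neg_abs_le_label_mul h1 (-⟪w, extendVec z 1⟫)
      rw [abs_neg] at h3
      have h4 : |⟪w, extendVec z 1⟫| ≤ ‖w‖ * (‖μ‖ / C + 1) :=
        (abs_real_inner_le_norm _ _).trans (by
          gcongr
          exact (norm_extendVec_le z zero_le_one).trans (by gcongr))
      linarith
    rw [mul_inner_extendVec_of_label w μ h1, ← hz] at hmargin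
    have h5 : ‖w‖ * (‖μ‖ / C + 1) = 1 / C * (‖w‖ * ‖μ‖) + ‖w‖ := by ring
    have h6 := mul_le_mul_of_nonneg_left hbig (norm_nonneg w)
    -- The inner product is at least (1 - 2/C)‖w‖‖μ‖ - ‖w‖. The first term is twice the target, and
    -- `h6` absorbs the loss of ‖w‖.
    nlinarith [norm_nonneg w]

end LargeSignal

/-! ### The main theorem -/

theorem theorem2 :
    ∃ C₁ : ℝ → ℝ → ℝ, (∀ r K : ℝ, 0 < C₁ r K) ∧
    ∀ C_H : ℝ, 2 < C_H → ∃ c : ℝ, 0 < c ∧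
    ∀ (n p : ℕ) (μ : EuclideanSpace ℝ (Fin p)) (S : Matrix (Fin p) (Fin p) ℝ)
      (r K k : ℝ) (l : ℝ≥0∞) (δ : ℝ)
      -- the population
      (Ω : Type*) [MeasurableSpace Ω] (P : Measure Ω) [IsProbabilityMeasure P]
      (y yN g : Ω → ℝ) (ξ : Fin p → Ω → ℝ)
      -- the training sample
      (T : Type*) [MeasurableSpace T] (Q : Measure T) [IsProbabilityMeasure Q]
      (D : Fin n → T → EuclideanSpace ℝ (Fin p) × ℝ),
      0 < n → μ ≠ 0 → 0 < δ → δ < 1 / 2 →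
      -- the noiseless model
      ModelEM P S 0 r K k l y yN g ξ →
      -- the sample consists of i.i.d. copies of the pair (feature, observed label)
      iIndepFun D Q →
      (∀ i, IdentDistrib (D i) (fun ω => (feature μ S y g ξ ω, yN ω)) Q P) →
      -- large signal
      3 * Real.sqrt 2 / 2 * C_H * (eLpNorm g l P).toReal * ((n : ℝ) / δ) ^ (l⁻¹).toReal
          * Real.sqrt S.trace ≤ ‖μ‖ →
      -- high dimension
      2 * C₁ r K * ((n : ℝ) / δ) ^ (2 / r)
          * max ((p : ℝ) ^ (2 / r - 1 / 2)) ((n : ℝ) ^ (2 / r)) * frobNorm S ≤ S.trace →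
      -- the second moment matrix of the extended noise exists, and the two forms of the bound agree
      (∀ a b, Integrable
        (fun ω => extendVec (noise S g ξ ω) 1 a * extendVec (noise S g ξ ω) 1 b) P) ∧
      specNorm (secondMoment P fun ω => extendVec (noise S g ξ ω) 1) / ‖extendVec μ 0‖ ^ 2
        = max (specNorm S) 1 / ‖μ‖ ^ 2 ∧
      ∃ A : Set T, MeasurableSet A ∧ 1 - 2 * δ ≤ Q.real A ∧
        ∀ τ ∈ A, ∃ w : EuclideanSpace ℝ (Fin p ⊕ Unit),
          IsMaxMargin (fun i => D i τ) w ∧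
          GDConvergesInDirection logisticLoss (fun i => D i τ) w ∧
          GDConvergesInDirection expLoss (fun i => D i τ) w ∧
          testError P (feature μ S y g ξ) y w
            ≤ c * (specNorm (secondMoment P fun ω => extendVec (noise S g ξ ω) 1)
                / ‖extendVec μ 0‖ ^ 2) := by
  refine ⟨fun _ K => 2 * (1 + |K|), fun _ K => by positivity, fun C hC => ?_⟩
  have hC0 : 0 < C := by linarith
  have hθ : 0 < 1 / 2 - 1 / C := by
    rw [sub_pos, div_lt_div_iff₀ hC0 (by norm_num)]; linarith
  -- The aligned case needs only the numerator 1; the 4 makes the bound trivial when (1/2 - 1/C)‖μ‖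
  -- < 2.
  refine ⟨4 / (1 / 2 - 1 / C) ^ 2, by positivity, ?_⟩
  intro n p μ S r K k l δ Ω _ P _ y yN g ξ T _ Q _ D hn hμ hδ hδ2 h _ hD hsignal hdim
  have hμ0 : 0 < ‖μ‖ := norm_pos_iff.mpr hμ
  have hform : specNorm (secondMoment P fun ω => extendVec (noise S g ξ ω) 1) /
      ‖extendVec μ 0‖ ^ 2 = max (specNorm S) 1 / ‖μ‖ ^ 2 := by
    rw [h.secondMoment_extendVec_noise, specNorm_fromBlocks_one, norm_extendVec_zero]
  refine ⟨h.integrable_extendVec_noise, hform, ?_⟩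
  have hn1 : (1 : ℝ) ≤ n := by exact_mod_cast hn
  have hN : 1 ≤ (n : ℝ) / δ := by
    rw [le_div_iff₀ hδ]; linarith
  have hdim' : 2 * (2 * (1 + |K|)) * ((n : ℝ) / δ) ^ (2 / r) * (p : ℝ) ^ (2 / r - 1 / 2) *
      frobNorm S ≤ S.trace := by
    refine le_trans ?_ hdim
    have := frobNorm_nonneg S
    gcongr
    exact le_max_left _ _
  have hsignal' : 3 * Real.sqrt 2 / 2 * (eLpNorm g l P).toReal * ((n : ℝ) / δ) ^ (l⁻¹).toReal *
      Real.sqrt S.trace ≤ ‖μ‖ / C := by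
    rw [le_div_iff₀ hC0]
    refine le_trans (le_of_eq ?_) hsignal
    ring
  have hbad := h.measureReal_compl_lowNoiseSet_le μ hN hdim' hsignal'
  have hEm := measurableSet_lowNoiseSet μ (‖μ‖ / C)
  set B : Set T := ⋂ i, D i ⁻¹' lowNoiseSet μ (‖μ‖ / C) with hB
  have hBm : NullMeasurableSet B Q :=
    NullMeasurableSet.iInter fun i => (hD i).aemeasurable_fst.nullMeasurableSet_preimage hEm
  have hBc : Q.real Bᶜ ≤ 2 * δ := by
    rw [hB, Set.compl_iInter]
    refine (measureReal_iUnion_fintype_le _).trans ?_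
    have hi : ∀ i ∈ Finset.univ, Q.real (D i ⁻¹' lowNoiseSet μ (‖μ‖ / C))ᶜ ≤
        2 * ((n : ℝ) / δ)⁻¹ := fun i _ => by
      rw [← Set.preimage_compl, Measure.real, (hD i).measure_mem_eq hEm.compl]
      exact hbad
    refine (Finset.sum_le_sum hi).trans (le_of_eq ?_)
    rw [Finset.sum_const, Finset.card_univ, Fintype.card_fin, nsmul_eq_mul]
    field_simp
  -- Equality in distribution yields only almost everywhere measurable samples, so the good event is
  -- replaced by a measurable subset of equal probability.
  obtain ⟨A, hAB, hAm, hAe⟩ := hBm.exists_measurable_subset_ae_eq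
  refine ⟨A, hAm, ?_, fun τ hτ => ?_⟩
  · rw [measureReal_congr hAe]
    rw [probReal_compl_eq_one_sub₀ hBm] at hBc
    linarith
  · have hd : ∀ i, D i τ ∈ lowNoiseSet μ (‖μ‖ / C) := fun i => Set.mem_iInter.mp (hAB hτ) i
    obtain ⟨w, hw⟩ := exists_isMaxMargin hμ hC hd
    refine ⟨w, hw, hw.gdConvergesInDirection isExpTailed_logisticLoss hn,
      hw.gdConvergesInDirection isExpTailed_expLoss hn, ?_⟩
    by_cases hbig : 2 ≤ (1 / 2 - 1 / C) * ‖μ‖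
    · obtain ⟨hw0, hal⟩ := hw.norm_mul_le_inner hn hμ hC hd hbig
      have hwn : 0 < ‖w‖ := norm_pos_iff.mpr hw0
      have hpos : 0 < (1 / 2 - 1 / C) * (‖w‖ * ‖μ‖) := by positivity
      refine (h.testError_le μ w (hpos.trans_le hal)).trans ?_
      have hM : 0 ≤ specNorm (secondMoment P fun ω => extendVec (noise S g ξ ω) 1) := norm_nonneg _
      rw [norm_extendVec_zero]
      calc _ ≤ specNorm (secondMoment P fun ω => extendVec (noise S g ξ ω) 1) * ‖w‖ ^ 2 /
            ((1 / 2 - 1 / C) * (‖w‖ * ‖μ‖)) ^ 2 := by gcongr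
        _ = 1 / (1 / 2 - 1 / C) ^ 2 *
            (specNorm (secondMoment P fun ω => extendVec (noise S g ξ ω) 1) / ‖μ‖ ^ 2) := by
          generalize 1 / 2 - 1 / C = θ at hθ
          field_simp
        _ ≤ _ := by gcongr; norm_num
    · push Not at hbig
      rw [hform]
      refine (measureReal_le_one).trans ?_
      rw [div_mul_div_comm, one_le_div (by positivity)]
      have h1 : ((1 / 2 - 1 / C) * ‖μ‖) ^ 2 ≤ 2 ^ 2 := by gcongr
      rw [mul_pow] at h1
      have h2 : (1 : ℝ) ≤ max (specNorm S) 1 := le_max_right _ _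
      linarith
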